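/- Let $n\ge 1$ and write points of $\mathbb{C}^n$ as $z=(z',z_n)$ with $z'\in\mathbb{C}^{n-1}$, $z=x+iy$. Let $T_B=\{x+iy:\ x\in\mathbb{R}^n,\ y\in\mathbb{R}^n,\ |y'|^2<y_n\}$, let $\rho(z)=y_n-|y'|^2$, and for $z,w\in T_B$ let $$\rho(z,w)=\tfrac14\Big((z'-\overline{w'})\cdot(z'-\overline{w'})-2i(z_n-\overline{w_n})\Big),\qquad u'\cdot u'=\sum_{j=1}^{n-1}u_j^2,$$ which has positive real part, so that its real powers are taken with the principal branch; note $\rho(z,z)=\rho(z)$. Let $dV$ be Lebesgue measure on $\mathbb{C}^n$. For $1\le p<\infty$ and $\lambda>-1$ let $A^p_\lambda(T_B)$ be the space of holomorphic functions $f$ on $T_B$ with $\int_{T_B}|f|^p\rho^\lambda\,dV<\infty$. For $\alpha>-1$ put $$\mathcal{T}_\alpha f(z)=\frac{\Gamma(n+1+\alpha)}{2^{n+1}\pi^n\Gamma(\alpha+1)}\int_{T_B}\frac{\rho(w)^\alpha}{\rho(z,w)^{n+1+\alpha}}f(w)\,dV(w).$$ Theorem D. Suppose that $1\le p<\infty$,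 $\lambda>-1$ and $\alpha\in\mathbb{R}$ satisfy $\alpha>\frac{\lambda+1}{p}-1$ if $p>1$, and $\alpha\ge\lambda$ if $p=1$. If $f\in A^p_\lambda(T_B)$, then for every $N\in\mathbb{N}_0$ and every $z\in T_B$ the integral defining $\mathcal{T}_\alpha(\rho^N\partial_{z_n}^N f)(z)$ converges absolutely, and $$f(z)=\frac{(-2i)^N\,\Gamma(1+\alpha)}{\Gamma(1+\alpha+N)}\ \mathcal{T}_\alpha\big(\rho^N\,\partial_{z_n}^N f\big)(z).$$ -/

import Mathlib

open MeasureTheory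

noncomputable section

namespace TubeDomain

/-- Complex `n`-space (for `1 ≤ n`), each point written `z = (z', z_n)` with `z' ∈ ℂ^{n-1}` and
`z_n ∈ ℂ`.  Its `volume` is the product measure, i.e. Lebesgue measure on `ℂ^n`. -/
abbrev Cn (n : ℕ) : Type := (Fin (n - 1) → ℂ) × ℂ

/-- `ρ(z) = y_n - |y'|^2`, where `y = Im z` and `|y'|` is the Euclidean length. -/
def rho {n : ℕ} (z : Cn n) : ℝ := z.2.im - ∑ j, (z.1 j).im ^ 2

/-- The tubular domain `T_B = {x + iy : x ∈ ℝ^n, |y'|^2 < y_n}`. -/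
def tube (n : ℕ) : Set (Cn n) := {z | ∑ j, (z.1 j).im ^ 2 < z.2.im}

/-- The sesquiholomorphic polarization
`ρ(z, w) = ((z' - conj w')^2 - 2i (z_n - conj w_n)) / 4`, with `u^2 = ∑ u_j^2`. -/
def rhoPair {n : ℕ} (z w : Cn n) : ℂ :=
  1 / 4 * ((∑ j, (z.1 j - (starRingEnd ℂ) (w.1 j)) ^ 2)
    - 2 * Complex.I * (z.2 - (starRingEnd ℂ) w.2))

/-- On the diagonal, `ρ(z, z) = ρ(z)`. -/
theorem rhoPair_self {n : ℕ} (z : Cn n) : rhoPair z z = (rho z : ℂ) := by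
  simp only [rhoPair, rho, Complex.sub_conj, mul_pow, Complex.I_sq,
    Complex.ofReal_sub, Complex.ofReal_sum, Complex.ofReal_pow, Complex.ofReal_mul,
    Complex.ofReal_ofNat]
  rw [← Finset.sum_mul, ← Finset.mul_sum]
  linear_combination (-(z.2.im : ℂ)) * Complex.I_sq

/-- On the tube, `ρ(z, w)` lies in the open right half-plane, so that its principal powers are
holomorphic in `z` and antiholomorphic in `w`. -/
theorem rhoPair_re_pos {n : ℕ} {z w : Cn n} (hz : z ∈ tube n) (hw : w ∈ tube n) :
    0 < (rhoPair z w).re := by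
  have h : (rhoPair z w).re =
      1 / 4 * ((∑ j, (((z.1 j).re - (w.1 j).re) ^ 2 - ((z.1 j).im + (w.1 j).im) ^ 2))
        + 2 * (z.2.im + w.2.im)) := by
    have hs : (∑ j, (z.1 j - (starRingEnd ℂ) (w.1 j)) ^ 2).re =
        ∑ j, (((z.1 j).re - (w.1 j).re) ^ 2 - ((z.1 j).im + (w.1 j).im) ^ 2) := by
      rw [Complex.re_sum]
      refine Finset.sum_congr rfl fun j _ => ?_
      simp [pow_two]
    have h4 : (1 / 4 : ℂ) = ((1 / 4 : ℝ) : ℂ) := by push_cast; rfl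
    rw [rhoPair, h4, Complex.re_ofReal_mul, Complex.sub_re, hs]
    simp
  have h2 : ∑ j, (-(2 * (z.1 j).im ^ 2 + 2 * (w.1 j).im ^ 2)) ≤
      ∑ j, (((z.1 j).re - (w.1 j).re) ^ 2 - ((z.1 j).im + (w.1 j).im) ^ 2) :=
    Finset.sum_le_sum fun j _ => by
      nlinarith [sq_nonneg ((z.1 j).re - (w.1 j).re), sq_nonneg ((z.1 j).im - (w.1 j).im)]
  rw [Finset.sum_neg_distrib, Finset.sum_add_distrib, ← Finset.mul_sum, ← Finset.mul_sum] at h2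
  have hz' : ∑ j, (z.1 j).im ^ 2 < z.2.im := hz
  have hw' : ∑ j, (w.1 j).im ^ 2 < w.2.im := hw
  rw [h]
  linarith

/-- The weighted measure `dV_lam = ρ^lam dV` on `T_B`. -/
def weightedVolume (n : ℕ) (lam : ℝ) : Measure (Cn n) :=
  (volume.restrict (tube n)).withDensity fun z => ENNReal.ofReal (rho z ^ lam)

/-- Membership in the weighted Bergman space `A^p_lam(T_B)`: holomorphic on `T_B` and
`p`-integrable on `T_B` with respect to `dV_lam`. -/
def MemBergman (n : ℕ) (p lam : ℝ) (f : Cn n → ℂ) : Prop :=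
  DifferentiableOn ℂ f (tube n) ∧ MemLp f (ENNReal.ofReal p) (weightedVolume n lam)

/-- The operator `∂/∂z_n`. -/
def partialLast {n : ℕ} (f : Cn n → ℂ) : Cn n → ℂ :=
  fun z => deriv (fun ζ : ℂ => f (z.1, ζ)) z.2

/-- The integrand `ρ(w)^α / ρ(z,w)^{n+1+α} · f(w)` of the operator `T_α`
(the complex power is the principal one). -/
def integrand {n : ℕ} (α : ℝ) (f : Cn n → ℂ) (z w : Cn n) : ℂ :=
  ((rho w ^ α : ℝ) : ℂ) / rhoPair z w ^ ((n + 1 + α : ℝ) : ℂ) * f w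

/-- The integral operator
`T_α f(z) = Γ(n+1+α) / (2^{n+1} π^n Γ(α+1)) ∫_{T_B} ρ(w)^α / ρ(z,w)^{n+1+α} f(w) dV(w)`. -/
def T {n : ℕ} (α : ℝ) (f : Cn n → ℂ) (z : Cn n) : ℂ :=
  ((Real.Gamma (n + 1 + α) / (2 ^ (n + 1) * Real.pi ^ n * Real.Gamma (α + 1)) : ℝ) : ℂ) *
    ∫ w in tube n, integrand α f z w

end TubeDomain

end

/-!
The integral is computed by two devices: coordinates in which `ρ(z, w)` depends on one variable
only, and an integration by parts that trades derivatives of `f` for a larger exponent.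

*No derivatives.*  Fix `z`.  The volume preserving biholomorphic map `siegelMap z` carries the
Siegel domain `{(v, u) : |v|²/2 < Im u}` onto `T_B`, and there `ρ = Im u - |v|²/2`, while `ρ(z, ·)`
is `-(i/2)(ζ - conj u)` for a fixed `ζ` in the upper half-plane.  So, for fixed `u`, the integral
over `v` is that of a holomorphic function against a radial weight on a ball, which the mean value
property evaluates (`integral_ball_mean`).  What remains is the reproducing formula on the upper
half-plane with exponent `α + n - 1` (`integral_halfPlane_reproducing`), and the Cayley transform
that takes `0` to `ζ` reduces it to the mean value property on the disc.  Together these give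
`integral_reproducing`, for every `α > -1` and every holomorphic `f` whose integral converges
absolutely.

*Derivatives.*  On a fibre `{w'} × {Im u > |Im w'|²}` the weight is constant along horizontal
lines, and there `∂_{w_n}` is the derivative in the real direction.  Integrating by parts in that
direction, with no boundary terms, moves the `N` derivatives from `f` to the kernel
(`integral_integrand_iterate`), so that the integral of the theorem becomes a multiple of the one
without derivatives for the exponent `α + N`.

*Convergence.*  For `N = 0` it is Hölder's inequality: relative to `ρ^lam dV`, the kernel lies in
the dual Lebesgue space (`exists_memLp_kernel`).  For `N > 0` the Cauchy formula on the circle about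
`u` of radius half the distance to the boundary bounds the derivative by values of `f` at points
where the weight is comparable, and Tonelli's theorem gives a weighted `L¹` bound
(`exists_lintegral_deriv_le`).
-/

noncomputable section

namespace TubeDomain

open Set

/-! ### Truncated powers and the mean value property on a disc -/

/-- The truncated power `x₊ᵃ`, equal to `xᵃ` for `x > 0` and to `0` otherwise.  With it, weighted
integrals over `{φ > 0}` become integrals over the whole space, which suits Fubini's theorem. -/
def posPow (a x : ℝ) : ℝ := if 0 < x then x ^ a else 0

theorem posPow_of_pos {a x : ℝ} (hx : 0 < x) : posPow a x = x ^ a := if_pos hx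

theorem posPow_of_nonpos {a x : ℝ} (hx : x ≤ 0) : posPow a x = 0 := if_neg hx.not_gt

theorem posPow_nonneg (a x : ℝ) : 0 ≤ posPow a x := by
  unfold posPow
  split_ifs with h
  · positivity
  · rfl

theorem measurable_posPow (a : ℝ) : Measurable (posPow a) :=
  Measurable.ite measurableSet_Ioi (measurable_id.pow_const a) measurable_const

/-- A function continuous where the weight `φ₊ᵃ` lives is measurable after multiplication by it. -/
theorem measurable_posPow_mul {X : Type*} [TopologicalSpace X] [MeasurableSpace X]
    [OpensMeasurableSpace X] {φ : X → ℝ} (hφ : Continuous φ) {h : X → ℂ}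
    (hh : ContinuousOn h {x | 0 < φ x}) (a : ℝ) :
    Measurable fun x => (posPow a (φ x) : ℂ) * h x := by
  have hs : MeasurableSet {x | 0 < φ x} := (isOpen_lt continuous_const hφ).measurableSet
  have hi : Measurable ({x | 0 < φ x}.indicator h) := by
    rw [← piecewise_eq_indicator]
    exact hh.measurable_piecewise continuousOn_const hs
  have : (fun x => (posPow a (φ x) : ℂ) * h x) =
      fun x => (posPow a (φ x) : ℂ) * {x | 0 < φ x}.indicator h x := by
    funext x
    by_cases hx : 0 < φ x
    · rw [indicator_of_mem (by exact hx)]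
    · simp [posPow_of_nonpos (not_lt.1 hx)]
  rw [this]
  exact (Complex.measurable_ofReal.comp ((measurable_posPow a).comp hφ.measurable)).mul hi

theorem radial_integral {a : ℝ} (ha : -1 < a) (t : ℝ) :
    IntegrableOn (fun r => r * posPow a (t - r ^ 2 / 2)) (Ioi 0) ∧
      ∫ r in Ioi (0 : ℝ), r * posPow a (t - r ^ 2 / 2) = posPow (a + 1) t / (a + 1) := by
  have ha' : 0 < a + 1 := by linarith
  rcases le_or_gt t 0 with ht | ht
  · have : ∀ r : ℝ, r * posPow a (t - r ^ 2 / 2) = 0 := fun r => by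
      rw [posPow_of_nonpos (by nlinarith [sq_nonneg r]), mul_zero]
    simp [this, posPow_of_nonpos ht]
  set R := √(2 * t) with hR
  have hR0 : 0 < R := by positivity
  have hR2 : R ^ 2 = 2 * t := Real.sq_sqrt (by positivity)
  have hpos : ∀ r ∈ Ioo 0 R, 0 < t - r ^ 2 / 2 := fun r hr => by
    have : r ^ 2 < R ^ 2 := pow_lt_pow_left₀ hr.2 hr.1.le two_ne_zero
    linarith
  have hzero : ∀ r ∈ Ioi R, r * posPow a (t - r ^ 2 / 2) = 0 := fun r hr => by
    have : R ^ 2 < r ^ 2 := pow_lt_pow_left₀ hr hR0.le two_ne_zero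
    rw [posPow_of_nonpos (by linarith), mul_zero]
  have hcont : ContinuousOn (fun r : ℝ => -((t - r ^ 2 / 2) ^ (a + 1)) / (a + 1)) (Icc 0 R) := by
    refine (ContinuousOn.neg ?_).div_const _
    exact ContinuousOn.rpow_const (by fun_prop) fun x _ => Or.inr ha'.le
  have hderiv : ∀ r ∈ Ioo 0 R, HasDerivAt (fun r : ℝ => -((t - r ^ 2 / 2) ^ (a + 1)) / (a + 1))
      (r * posPow a (t - r ^ 2 / 2)) r := fun r hr => by
    have h1 : HasDerivAt (fun r : ℝ => t - r ^ 2 / 2) (-r) r := by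
      refine (((hasDerivAt_pow 2 r).div_const 2).const_sub t).congr_deriv ?_
      simp
    have h2 := ((h1.rpow_const (p := a + 1) (Or.inl (hpos r hr).ne')).neg).div_const (a + 1)
    refine h2.congr_deriv ?_
    rw [posPow_of_pos (hpos r hr)]
    field_simp
    ring_nf
  have hnn : ∀ r ∈ Ioo 0 R, 0 ≤ r * posPow a (t - r ^ 2 / 2) := fun r hr =>
    mul_nonneg hr.1.le (posPow_nonneg _ _)
  have hint := intervalIntegral.integrableOn_deriv_of_nonneg hcont hderiv hnn
  have hval := intervalIntegral.integral_eq_sub_of_hasDerivAt_of_le hR0.le hcont hderiv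
    ((intervalIntegrable_iff_integrableOn_Ioc_of_le hR0.le).2 hint)
  have hint' : IntegrableOn (fun r => r * posPow a (t - r ^ 2 / 2)) (Ioi R) :=
    integrableOn_zero.congr_fun (fun r hr => (hzero r hr).symm) measurableSet_Ioi
  rw [← Ioc_union_Ioi_eq_Ioi hR0.le]
  refine ⟨hint.union hint', ?_⟩
  rw [setIntegral_union (Ioc_disjoint_Ioi le_rfl) measurableSet_Ioi hint hint',
    setIntegral_congr_fun measurableSet_Ioi hzero, ← intervalIntegral.integral_of_le hR0.le, hval,
    hR2, posPow_of_pos ht]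
  simp [Real.zero_rpow ha'.ne']
  ring

theorem polar_symm_eq (r θ : ℝ) : (Complex.polarCoord.symm (r, θ) : ℂ) = circleMap 0 r θ := by
  rw [Complex.polarCoord_symm_apply, circleMap, Complex.exp_mul_I]
  simp

theorem norm_circleMap_sq (r θ : ℝ) : ‖circleMap 0 r θ‖ ^ 2 = r ^ 2 := by
  simp [circleMap]

/-- The mean value property on the circle `|ξ| = r`, in the angular range of polar coordinates. -/
theorem integral_circleMap_of_differentiableOn {h : ℂ → ℂ} {t r : ℝ} (hr : 0 < r)
    (hrt : r ^ 2 / 2 < t)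
    (hh : DifferentiableOn ℂ h {ξ | 0 < t - ‖ξ‖ ^ 2 / 2}) :
    ∫ θ in Ioo (-Real.pi) Real.pi, h (circleMap 0 r θ) = 2 * Real.pi * h 0 := by
  have hsub : Metric.closedBall (0 : ℂ) r ⊆ {ξ | 0 < t - ‖ξ‖ ^ 2 / 2} := fun ξ hξ => by
    have h1 : ‖ξ‖ ≤ r := by simpa using hξ
    have : ‖ξ‖ ^ 2 ≤ r ^ 2 := pow_le_pow_left₀ (norm_nonneg _) h1 2
    show 0 < t - ‖ξ‖ ^ 2 / 2
    linarith
  have hd : DiffContOnCl ℂ h (Metric.ball 0 |r|) := by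
    rw [abs_of_pos hr]
    exact (hh.mono hsub).diffContOnCl_ball le_rfl
  have hmean := hd.circleAverage
  rw [Real.circleAverage_def] at hmean
  have hper : Function.Periodic (fun θ => h (circleMap 0 r θ)) (2 * Real.pi) := fun θ => by
    simp only [periodic_circleMap 0 r θ]
  rw [← integral_Ioc_eq_integral_Ioo, ← intervalIntegral.integral_of_le (by linarith [Real.pi_pos])]
  have := hper.intervalIntegral_add_eq (-Real.pi) 0
  rw [show -Real.pi + 2 * Real.pi = Real.pi by ring, zero_add] at this
  rw [this, ← hmean]
  simp only [Complex.real_smul]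
  push_cast
  field_simp

/-- The weighted mean value property on a disc. -/
theorem integral_disc_mean {a : ℝ} (ha : -1 < a) (t : ℝ) {h : ℂ → ℂ}
    (hh : DifferentiableOn ℂ h {ξ | 0 < t - ‖ξ‖ ^ 2 / 2})
    (hint : Integrable fun ξ : ℂ => (posPow a (t - ‖ξ‖ ^ 2 / 2) : ℂ) * h ξ) :
    ∫ ξ : ℂ, (posPow a (t - ‖ξ‖ ^ 2 / 2) : ℂ) * h ξ =
      (2 * Real.pi / (a + 1) * posPow (a + 1) t : ℝ) * h 0 := by
  set F : ℂ → ℂ := fun ξ => (posPow a (t - ‖ξ‖ ^ 2 / 2) : ℂ) * h ξ with hF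
  have hFm : Measurable F := measurable_posPow_mul (φ := fun ξ : ℂ => t - ‖ξ‖ ^ 2 / 2)
    (by fun_prop) hh.continuousOn a
  have hGm : Measurable fun p : ℝ × ℝ => p.1 • F (circleMap 0 p.1 p.2) := by
    refine measurable_fst.smul (hFm.comp (Continuous.measurable ?_))
    unfold circleMap
    fun_prop
  have hGint : IntegrableOn (fun p : ℝ × ℝ => p.1 • F (circleMap 0 p.1 p.2))
      (Ioi 0 ×ˢ Ioo (-Real.pi) Real.pi) := by
    refine ⟨hGm.aestronglyMeasurable, ?_⟩
    have h1 := hint.2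
    rw [HasFiniteIntegral, ← Complex.lintegral_comp_polarCoord_symm, polarCoord_target] at h1
    rw [HasFiniteIntegral]
    refine lt_of_eq_of_lt (setLIntegral_congr_fun
      (measurableSet_Ioi.prod measurableSet_Ioo) fun p hp => ?_) h1
    simp only [← polar_symm_eq, enorm_smul, smul_eq_mul]
    rw [Real.enorm_of_nonneg (le_of_lt hp.1)]
  rw [← Complex.integral_comp_polarCoord_symm, polarCoord_target]
  have h2 : ∀ r ∈ Ioi (0 : ℝ), (∫ θ in Ioo (-Real.pi) Real.pi, r • F (circleMap 0 r θ)) =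
      ((r * posPow a (t - r ^ 2 / 2) : ℝ) : ℂ) * (2 * Real.pi * h 0) := fun r hr => by
    simp only [hF, norm_circleMap_sq, Complex.real_smul]
    rw [integral_const_mul, integral_const_mul]
    rcases lt_or_ge (r ^ 2 / 2) t with hrt | hrt
    · rw [integral_circleMap_of_differentiableOn hr hrt hh]
      push_cast
      ring
    · simp [posPow_of_nonpos (show t - r ^ 2 / 2 ≤ 0 by linarith)]
  calc ∫ p in Ioi 0 ×ˢ Ioo (-Real.pi) Real.pi, p.1 • F (Complex.polarCoord.symm p)
      = ∫ p in Ioi (0 : ℝ) ×ˢ Ioo (-Real.pi) Real.pi, p.1 • F (circleMap 0 p.1 p.2) := by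
        simp only [← polar_symm_eq]
    _ = ∫ r in Ioi (0 : ℝ), ∫ θ in Ioo (-Real.pi) Real.pi, r • F (circleMap 0 r θ) := by
        rw [Measure.volume_eq_prod] at hGint ⊢
        exact setIntegral_prod _ hGint
    _ = ∫ r in Ioi (0 : ℝ), ((r * posPow a (t - r ^ 2 / 2) : ℝ) : ℂ) * (2 * Real.pi * h 0) :=
        setIntegral_congr_fun measurableSet_Ioi h2
    _ = _ := by
        rw [integral_mul_const, integral_complex_ofReal, (radial_integral ha t).2]
        push_cast
        ring

theorem lintegral_disc {a : ℝ} (ha : -1 < a) (t : ℝ) :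
    ∫⁻ ξ : ℂ, ENNReal.ofReal (posPow a (t - ‖ξ‖ ^ 2 / 2)) =
      ENNReal.ofReal (2 * Real.pi / (a + 1) * posPow (a + 1) t) := by
  have hm : Measurable fun p : ℝ × ℝ => ENNReal.ofReal (p.1 * posPow a (t - p.1 ^ 2 / 2)) :=
    (measurable_fst.mul ((measurable_posPow a).comp (by fun_prop))).ennreal_ofReal
  rw [← Complex.lintegral_comp_polarCoord_symm, polarCoord_target]
  calc ∫⁻ p in Ioi (0 : ℝ) ×ˢ Ioo (-Real.pi) Real.pi, ENNReal.ofReal p.1 •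
        ENNReal.ofReal (posPow a (t - ‖(Complex.polarCoord.symm p : ℂ)‖ ^ 2 / 2))
      = ∫⁻ p in Ioi (0 : ℝ) ×ˢ Ioo (-Real.pi) Real.pi,
          ENNReal.ofReal (p.1 * posPow a (t - p.1 ^ 2 / 2)) := by
        refine setLIntegral_congr_fun (measurableSet_Ioi.prod measurableSet_Ioo) fun p hp => ?_
        simp only [Complex.norm_polarCoord_symm, sq_abs, smul_eq_mul]
        rw [ENNReal.ofReal_mul (le_of_lt hp.1)]
    _ = ∫⁻ r in Ioi (0 : ℝ), ∫⁻ _ in Ioo (-Real.pi) Real.pi,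
          ENNReal.ofReal (r * posPow a (t - r ^ 2 / 2)) := by
        rw [Measure.volume_eq_prod, setLIntegral_prod _ hm.aemeasurable]
    _ = _ := by
        simp only [lintegral_const, Measure.restrict_apply MeasurableSet.univ, univ_inter,
          Real.volume_Ioo]
        have hm' : Measurable fun r : ℝ => ENNReal.ofReal (r * posPow a (t - r ^ 2 / 2)) :=
          hm.comp (measurable_id.prodMk (measurable_const (a := (0 : ℝ))))
        rw [lintegral_mul_const _ hm',
          ← ofReal_integral_eq_lintegral_ofReal (radial_integral ha t).1
            ((ae_restrict_iff' measurableSet_Ioi).2 (Filter.Eventually.of_forall fun r hr =>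
              mul_nonneg (le_of_lt hr) (posPow_nonneg _ _))),
          (radial_integral ha t).2, ← ENNReal.ofReal_mul]
        · congr 1
          ring
        · exact div_nonneg (posPow_nonneg _ _) (by linarith)

/-! ### The mean value property on a ball -/

/-- The integral of `(1 - |v|²/2)₊ᵃ` over `ℂᵐ`. -/
def ballConst (m : ℕ) (a : ℝ) : ℝ :=
  (2 * Real.pi) ^ m * Real.Gamma (a + 1) / Real.Gamma (a + m + 1)

theorem ballConst_pos (m : ℕ) {a : ℝ} (ha : -1 < a) : 0 < ballConst m a := by
  have h1 : 0 < Real.Gamma (a + 1) := Real.Gamma_pos_of_pos (by linarith)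
  have h2 : 0 < Real.Gamma (a + m + 1) :=
    Real.Gamma_pos_of_pos (by linarith [Nat.cast_nonneg (α := ℝ) m])
  unfold ballConst
  positivity

theorem ballConst_zero {a : ℝ} (ha : -1 < a) : ballConst 0 a = 1 := by
  have h1 : 0 < Real.Gamma (a + 1) := Real.Gamma_pos_of_pos (by linarith)
  simp [ballConst, h1.ne']

theorem ballConst_succ (m : ℕ) {a : ℝ} (ha : -1 < a) :
    ballConst (m + 1) a = 2 * Real.pi / (a + 1) * ballConst m (a + 1) := by
  have h0 : a + 1 ≠ 0 := by linarith
  unfold ballConst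
  rw [Real.Gamma_add_one h0]
  push_cast
  rw [show a + 1 + (m : ℝ) + 1 = a + (m + 1) + 1 by ring]
  field_simp
  ring

theorem measurePreserving_cons (m : ℕ) :
    MeasurePreserving (MeasurableEquiv.piFinSuccAbove (fun _ : Fin (m + 1) => ℂ) 0).symm
      ((volume : Measure ℂ).prod (volume : Measure (Fin m → ℂ))) volume :=
  (volume_preserving_piFinSuccAbove (fun _ : Fin (m + 1) => ℂ) 0).symm

theorem piFinSuccAbove_symm_eq_cons {m : ℕ} (p : ℂ × (Fin m → ℂ)) :
    (MeasurableEquiv.piFinSuccAbove (fun _ : Fin (m + 1) => ℂ) 0).symm p =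
      (Fin.cons p.1 p.2 : Fin (m + 1) → ℂ) := by
  simp [MeasurableEquiv.piFinSuccAbove, Fin.insertNthEquiv]

theorem lintegral_ball (m : ℕ) {a : ℝ} (ha : -1 < a) (t : ℝ) :
    ∫⁻ v : Fin m → ℂ, ENNReal.ofReal (posPow a (t - (∑ j, ‖v j‖ ^ 2) / 2)) =
      ENNReal.ofReal (ballConst m a * posPow (a + m) t) := by
  induction m generalizing a with
  | zero =>
    rw [Measure.volume_pi_eq_dirac (Fin.elim0 : Fin 0 → ℂ)]
    simp [ballConst_zero ha]
  | succ m ih =>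
    have hm : Measurable fun p : ℂ × (Fin m → ℂ) =>
        ENNReal.ofReal (posPow a (t - (‖p.1‖ ^ 2 + ∑ j, ‖p.2 j‖ ^ 2) / 2)) :=
      ((measurable_posPow a).comp (by fun_prop)).ennreal_ofReal
    rw [← (measurePreserving_cons m).lintegral_comp_emb (MeasurableEquiv.measurableEmbedding _)]
    simp only [piFinSuccAbove_symm_eq_cons, Fin.sum_univ_succ, Fin.cons_zero, Fin.cons_succ]
    rw [lintegral_prod_symm _ hm.aemeasurable]
    have h1 : ∀ w : Fin m → ℂ, ∫⁻ ξ : ℂ,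
        ENNReal.ofReal (posPow a (t - (‖ξ‖ ^ 2 + ∑ j, ‖w j‖ ^ 2) / 2)) =
        ENNReal.ofReal (2 * Real.pi / (a + 1)) *
          ENNReal.ofReal (posPow (a + 1) (t - (∑ j, ‖w j‖ ^ 2) / 2)) := fun w => by
      rw [← ENNReal.ofReal_mul (div_nonneg (by positivity) (by linarith)), ← lintegral_disc ha]
      refine lintegral_congr fun ξ => ?_
      congr 2
      ring
    simp only [h1]
    have hm1 : Measurable fun w : Fin m → ℂ =>
        ENNReal.ofReal (posPow (a + 1) (t - (∑ j, ‖w j‖ ^ 2) / 2)) :=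
      ((measurable_posPow (a + 1)).comp (by fun_prop)).ennreal_ofReal
    rw [lintegral_const_mul _ hm1, ih (by linarith),
      ← ENNReal.ofReal_mul (div_nonneg (by positivity) (by linarith)), ballConst_succ m ha]
    push_cast
    rw [show a + 1 + (m : ℝ) = a + (m + 1) by ring, mul_assoc]

/-- The weighted mean value property on a ball of `ℂᵐ`, proved one coordinate at a time: averaging
over one coordinate turns the exponent `a` into `a + 1`. -/
theorem integral_ball_mean (m : ℕ) {a : ℝ} (ha : -1 < a) (t : ℝ) {h : (Fin m → ℂ) → ℂ}
    (hh : DifferentiableOn ℂ h {v | 0 < t - (∑ j, ‖v j‖ ^ 2) / 2})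
    (hint : Integrable fun v => (posPow a (t - (∑ j, ‖v j‖ ^ 2) / 2) : ℂ) * h v) :
    ∫ v, (posPow a (t - (∑ j, ‖v j‖ ^ 2) / 2) : ℂ) * h v =
      (ballConst m a * posPow (a + m) t : ℝ) * h 0 := by
  induction m generalizing a with
  | zero =>
    rw [Measure.volume_pi_eq_dirac (Fin.elim0 : Fin 0 → ℂ)]
    simp [ballConst_zero ha, Subsingleton.elim (Fin.elim0 : Fin 0 → ℂ) 0]
  | succ m ih =>
    have ha1 : 0 < a + 1 := by linarith
    have hcd : Differentiable ℂ fun p : ℂ × (Fin m → ℂ) =>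
        (Fin.cons p.1 p.2 : Fin (m + 1) → ℂ) := by
      refine differentiable_pi.2 fun j => ?_
      refine Fin.cases ?_ (fun i => ?_) j
      · simp only [Fin.cons_zero]
        fun_prop
      · simp only [Fin.cons_succ]
        fun_prop
    have hcd0 : Differentiable ℂ fun w : Fin m → ℂ => (Fin.cons 0 w : Fin (m + 1) → ℂ) :=
      hcd.comp ((differentiable_const (0 : ℂ)).prodMk differentiable_id)
    have hcd1 : ∀ w : Fin m → ℂ, Differentiable ℂ fun ξ : ℂ => (Fin.cons ξ w : Fin (m + 1) → ℂ) :=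
      fun w => hcd.comp (differentiable_id.prodMk (differentiable_const w))
    have hsplit : ∀ (ξ : ℂ) (w : Fin m → ℂ),
        t - (∑ j, ‖(Fin.cons ξ w : Fin (m + 1) → ℂ) j‖ ^ 2) / 2 =
          t - (∑ j, ‖w j‖ ^ 2) / 2 - ‖ξ‖ ^ 2 / 2 := fun ξ w => by
      rw [Fin.sum_univ_succ]
      simp only [Fin.cons_zero, Fin.cons_succ]
      ring
    rw [← (measurePreserving_cons m).integral_comp (MeasurableEquiv.measurableEmbedding _)]
    rw [← (measurePreserving_cons m).integrable_comp_emb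
      (MeasurableEquiv.measurableEmbedding _)] at hint
    simp only [Function.comp_def, piFinSuccAbove_symm_eq_cons, hsplit] at hint ⊢
    have hslice : ∀ᵐ w : Fin m → ℂ, ∫ ξ : ℂ,
        (posPow a (t - (∑ j, ‖w j‖ ^ 2) / 2 - ‖ξ‖ ^ 2 / 2) : ℂ) * h (Fin.cons ξ w) =
        ((2 * Real.pi / (a + 1) : ℝ) : ℂ) *
          ((posPow (a + 1) (t - (∑ j, ‖w j‖ ^ 2) / 2) : ℂ) * h (Fin.cons 0 w)) := by
      filter_upwards [hint.prod_left_ae] with w hw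
      rw [integral_disc_mean (h := fun ξ => h (Fin.cons ξ w)) ha _ ?_ hw]
      · push_cast
        ring
      · refine hh.comp (hcd1 w).differentiableOn fun ξ hξ => ?_
        simpa only [mem_ofPred_eq, hsplit] using hξ
    have hmarg := hint.integral_prod_right.congr hslice
    have hmarg' : Integrable fun w : Fin m → ℂ =>
        (posPow (a + 1) (t - (∑ j, ‖w j‖ ^ 2) / 2) : ℂ) * h (Fin.cons 0 w) := by
      have hne : ((2 * Real.pi / (a + 1) : ℝ) : ℂ) ≠ 0 := by
        exact_mod_cast (div_pos (by positivity) ha1).ne'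
      refine (hmarg.const_mul (((2 * Real.pi / (a + 1) : ℝ) : ℂ)⁻¹)).congr
        (Filter.Eventually.of_forall fun w => ?_)
      show _⁻¹ * (_ * _) = _
      rw [inv_mul_cancel_left₀ hne]
    rw [integral_prod_symm _ hint, integral_congr_ae hslice, integral_const_mul,
      ih (h := fun w => h (Fin.cons 0 w)) (by linarith) ?_ hmarg', ballConst_succ m ha]
    · have : (Fin.cons 0 0 : Fin (m + 1) → ℂ) = 0 := by
        ext j
        refine Fin.cases ?_ (fun i => ?_) j <;> simp
      rw [this]
      push_cast
      rw [show a + 1 + (m : ℝ) = a + (m + 1) by ring]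
      ring
    · refine hh.comp hcd0.differentiableOn fun w hw => ?_
      rw [mem_ofPred_eq, hsplit]
      simpa using hw

/-! ### The reproducing formula on the upper half-plane -/

/-- The one-dimensional polarization `-(i/2)(ζ - conj u)`: in the last variable, with the others
fixed, `rhoPair` has this form. -/
def halfPair (ζ u : ℂ) : ℂ := -(Complex.I / 2) * (ζ - (starRingEnd ℂ) u)

theorem halfPair_re (ζ u : ℂ) : (halfPair ζ u).re = (ζ.im + u.im) / 2 := by
  simp [halfPair]
  ring

theorem continuous_halfPair (ζ : ℂ) : Continuous (halfPair ζ) := by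
  unfold halfPair
  fun_prop

theorem re_le_norm_halfPair (ζ u : ℂ) : (ζ.im + u.im) / 2 ≤ ‖halfPair ζ u‖ :=
  halfPair_re ζ u ▸ Complex.re_le_norm _

theorem ofReal_mul_cpow {r : ℝ} (hr : 0 < r) {x : ℂ} (hx : x ≠ 0) (s : ℂ) :
    ((r : ℂ) * x) ^ s = (r : ℂ) ^ s * x ^ s := by
  have hr' : (r : ℂ) ≠ 0 := by exact_mod_cast hr.ne'
  rw [Complex.cpow_def_of_ne_zero (mul_ne_zero hr' hx), Complex.cpow_def_of_ne_zero hr',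
    Complex.cpow_def_of_ne_zero hx, Complex.log_ofReal_mul hr hx, ← Complex.exp_add,
    Complex.ofReal_log hr.le]
  ring_nf

/-- The Cayley transform of the unit disc onto the upper half-plane taking `0` to `ζ`. -/
def cayley (ζ ξ : ℂ) : ℂ := (ζ - (starRingEnd ℂ) ζ * ξ) / (1 - ξ)

theorem one_sub_ne_zero {ξ : ℂ} (hξ : ‖ξ‖ < 1) : 1 - ξ ≠ 0 := by
  intro h
  rw [← sub_eq_zero.1 h] at hξ
  simp at hξ

theorem one_sub_re_pos {ξ : ℂ} (hξ : ‖ξ‖ < 1) : 0 < (1 - ξ).re := by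
  have := Complex.re_le_norm ξ
  simp only [Complex.sub_re, Complex.one_re]
  linarith

theorem halfPair_cayley (ζ : ℂ) {ξ : ℂ} (hξ : ‖ξ‖ < 1) :
    halfPair ζ (cayley ζ ξ) = ((ζ.im / Complex.normSq (1 - ξ) : ℝ) : ℂ) * (1 - ξ) := by
  have h1 := one_sub_ne_zero hξ
  have h2 : 1 - (starRingEnd ℂ) ξ ≠ 0 := by
    simpa using (map_ne_zero (starRingEnd ℂ)).2 h1
  have h3 : ζ - (starRingEnd ℂ) ζ = 2 * ζ.im * Complex.I := by
    rw [Complex.sub_conj]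
    push_cast
    ring
  rw [Complex.ofReal_div, ← Complex.mul_conj]
  simp only [halfPair, cayley, map_div₀, map_sub, map_mul, Complex.conj_conj, map_one]
  field_simp
  linear_combination (-Complex.I) * h3 - 2 * (ζ.im : ℂ) * Complex.I_sq

theorem cayley_im (ζ : ℂ) {ξ : ℂ} (hξ : ‖ξ‖ < 1) :
    (cayley ζ ξ).im = ζ.im / Complex.normSq (1 - ξ) * (1 - ‖ξ‖ ^ 2) := by
  have h1 : Complex.normSq (1 - ξ) ≠ 0 := by simpa using one_sub_ne_zero hξ
  rw [← Complex.normSq_eq_norm_sq]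
  rw [cayley, Complex.div_im]
  field_simp
  simp [Complex.normSq_apply]
  ring

theorem hasDerivAt_cayley (ζ : ℂ) {ξ : ℂ} (hξ : ‖ξ‖ < 1) :
    HasDerivAt (cayley ζ) (2 * ζ.im * Complex.I / (1 - ξ) ^ 2) ξ := by
  have h1 := one_sub_ne_zero hξ
  have h3 : ζ - (starRingEnd ℂ) ζ = 2 * ζ.im * Complex.I := by
    rw [Complex.sub_conj]
    push_cast
    ring
  have hn : HasDerivAt (fun ξ : ℂ => ζ - (starRingEnd ℂ) ζ * ξ) (-((starRingEnd ℂ) ζ * 1)) ξ :=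
    ((hasDerivAt_id ξ).const_mul _).const_sub _
  have hd : HasDerivAt (fun ξ : ℂ => 1 - ξ) (-1) ξ := (hasDerivAt_id ξ).const_sub _
  refine (hn.div hd h1).congr_deriv ?_
  rw [← h3]
  congr 1
  ring

theorem injOn_cayley {ζ : ℂ} (hζ : 0 < ζ.im) : InjOn (cayley ζ) (Metric.ball 0 1) := by
  intro ξ hξ ξ' hξ' h
  have h1 := one_sub_ne_zero (by simpa using hξ)
  have h2 := one_sub_ne_zero (by simpa using hξ')
  have h3 : ζ - (starRingEnd ℂ) ζ ≠ 0 := by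
    rw [Complex.sub_conj]
    simp [hζ.ne']
  rw [cayley, cayley, div_eq_div_iff h1 h2] at h
  refine mul_left_cancel₀ h3 ?_
  linear_combination h

theorem image_cayley {ζ : ℂ} (hζ : 0 < ζ.im) :
    cayley ζ '' Metric.ball 0 1 = {u | 0 < u.im} := by
  ext u
  constructor
  · rintro ⟨ξ, hξ, rfl⟩
    have hξ' : ‖ξ‖ < 1 := by simpa using hξ
    show 0 < (cayley ζ ξ).im
    rw [cayley_im ζ hξ']
    have h1 : 0 < Complex.normSq (1 - ξ) := Complex.normSq_pos.2 (one_sub_ne_zero hξ')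
    have h2 : 0 < 1 - ‖ξ‖ ^ 2 := by nlinarith [norm_nonneg ξ]
    positivity
  · intro hu
    have hu' : 0 < u.im := hu
    have hne : u - (starRingEnd ℂ) ζ ≠ 0 := by
      intro h
      have := congrArg Complex.im h
      simp at this
      linarith
    have h3 : ζ - (starRingEnd ℂ) ζ ≠ 0 := by
      rw [Complex.sub_conj]
      simp [hζ.ne']
    refine ⟨(u - ζ) / (u - (starRingEnd ℂ) ζ), ?_, ?_⟩
    · rw [mem_ball_zero_iff, norm_div, div_lt_one (norm_pos_iff.2 hne)]
      refine lt_of_pow_lt_pow_left₀ 2 (norm_nonneg _) ?_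
      rw [← Complex.normSq_eq_norm_sq, ← Complex.normSq_eq_norm_sq, Complex.normSq_apply,
        Complex.normSq_apply]
      simp
      nlinarith [mul_pos hu' hζ]
    · have : 1 - (u - ζ) / (u - (starRingEnd ℂ) ζ) =
          (ζ - (starRingEnd ℂ) ζ) / (u - (starRingEnd ℂ) ζ) := by
        field_simp
        ring
      rw [cayley, this]
      field_simp
      ring

theorem abs_det_restrictScalars_mul (c : ℂ) :
    |((ContinuousLinearMap.toSpanSingleton ℂ c).restrictScalars ℝ : ℂ →L[ℝ] ℂ).det| =
      Complex.normSq c := by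
  have : ((ContinuousLinearMap.toSpanSingleton ℂ c).restrictScalars ℝ : ℂ →L[ℝ] ℂ).det =
      Complex.normSq c := by
    rw [ContinuousLinearMap.det, ← LinearMap.det_toMatrix Complex.basisOneI, Matrix.det_fin_two]
    simp [LinearMap.toMatrix_apply, Complex.normSq_apply]
  rw [this, abs_of_nonneg (Complex.normSq_nonneg c)]

/-- The reproducing formula on the upper half-plane.  The Cayley transform taking `0` to `ζ` turns
the integrand into `(1 - |ξ|²)ᵃ` times a holomorphic function with value `h ζ` at `0`. -/
theorem integral_halfPlane_reproducing {a : ℝ} (ha : -1 < a) {ζ : ℂ} (hζ : 0 < ζ.im) {h : ℂ → ℂ}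
    (hh : DifferentiableOn ℂ h {u | 0 < u.im})
    (hint : Integrable fun u : ℂ =>
      (posPow a u.im : ℂ) * (h u / halfPair ζ u ^ ((2 + a : ℝ) : ℂ))) :
    ∫ u : ℂ, (posPow a u.im : ℂ) * (h u / halfPair ζ u ^ ((2 + a : ℝ) : ℂ)) =
      (4 * Real.pi / (a + 1) : ℝ) * h ζ := by
  set F : ℂ → ℂ := fun u => (posPow a u.im : ℂ) * (h u / halfPair ζ u ^ ((2 + a : ℝ) : ℂ)) with hF
  set G : ℂ → ℂ := fun ξ => h (cayley ζ ξ) / (1 - ξ) ^ ((2 + a : ℝ) : ℂ) with hG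
  set φ' : ℂ → ℂ →L[ℝ] ℂ := fun ξ => (ContinuousLinearMap.toSpanSingleton ℂ
    (2 * ζ.im * Complex.I / (1 - ξ) ^ 2)).restrictScalars ℝ with hφ'
  have hder : ∀ ξ ∈ Metric.ball (0 : ℂ) 1,
      HasFDerivWithinAt (cayley ζ) (φ' ξ) (Metric.ball 0 1) ξ := fun ξ hξ =>
    ((hasDerivAt_cayley ζ (by simpa using hξ)).hasFDerivAt.restrictScalars ℝ).hasFDerivWithinAt
  have hball : MeasurableSet (Metric.ball (0 : ℂ) 1) := measurableSet_ball
  have hset : ∀ ξ : ℂ, 0 < 1 / 2 - ‖ξ‖ ^ 2 / 2 ↔ ξ ∈ Metric.ball (0 : ℂ) 1 := fun ξ => by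
    rw [mem_ball_zero_iff]
    constructor
    · intro h
      nlinarith [norm_nonneg ξ]
    · intro h
      nlinarith [norm_nonneg ξ]
  have hpt : ∀ ξ ∈ Metric.ball (0 : ℂ) 1, |(φ' ξ).det| • F (cayley ζ ξ) =
      ((4 * 2 ^ a : ℝ) : ℂ) * ((posPow a (1 / 2 - ‖ξ‖ ^ 2 / 2) : ℂ) * G ξ) := fun ξ hξ => by
    have hξ' : ‖ξ‖ < 1 := by simpa using hξ
    have hN : 0 < Complex.normSq (1 - ξ) := Complex.normSq_pos.2 (one_sub_ne_zero hξ')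
    set r : ℝ := ζ.im / Complex.normSq (1 - ξ) with hr
    have hr0 : 0 < r := by positivity
    have hx : 0 < 1 - ‖ξ‖ ^ 2 := by have := (hset ξ).2 hξ; linarith
    have hdet : |(φ' ξ).det| = 4 * r ^ 2 := by
      rw [hφ', abs_det_restrictScalars_mul, hr]
      simp
      ring
    have hra : r ^ (2 + a) = r ^ 2 * r ^ a := by
      rw [Real.rpow_add hr0, Real.rpow_two]
    rw [hdet, hF, hG]
    simp only []
    rw [halfPair_cayley ζ hξ', cayley_im ζ hξ', ← hr, posPow_of_pos (by positivity),
      posPow_of_pos ((hset ξ).2 hξ), ofReal_mul_cpow hr0 (one_sub_ne_zero hξ'),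
      ← Complex.ofReal_cpow hr0.le, hra, Real.mul_rpow hr0.le hx.le,
      show (1 : ℝ) / 2 - ‖ξ‖ ^ 2 / 2 = (1 - ‖ξ‖ ^ 2) / 2 by ring,
      Real.div_rpow hx.le (by norm_num), Complex.real_smul]
    have h1 : ((r ^ a : ℝ) : ℂ) ≠ 0 := by exact_mod_cast (Real.rpow_pos_of_pos hr0 a).ne'
    have h2 : (r : ℂ) ≠ 0 := by exact_mod_cast hr0.ne'
    have h3 : ((2 ^ a : ℝ) : ℂ) ≠ 0 := by
      exact_mod_cast (Real.rpow_pos_of_pos (by norm_num : (0 : ℝ) < 2) a).ne'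
    have h4 : (1 - ξ) ^ ((2 + a : ℝ) : ℂ) ≠ 0 := by
      rw [Complex.cpow_ne_zero_iff]
      exact Or.inl (one_sub_ne_zero hξ')
    simp only [Complex.ofReal_mul, Complex.ofReal_div, Complex.ofReal_pow]
    field_simp
  have hFs : ∀ u, u ∉ {u : ℂ | 0 < u.im} → F u = 0 := fun u hu => by
    simp only [hF]
    rw [posPow_of_nonpos (not_lt.1 hu)]
    simp
  have hGs : ∀ ξ, ξ ∉ Metric.ball (0 : ℂ) 1 →
      (posPow a (1 / 2 - ‖ξ‖ ^ 2 / 2) : ℂ) * G ξ = 0 := fun ξ hξ => by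
    rw [posPow_of_nonpos (not_lt.1 (mt (hset ξ).1 hξ))]
    simp
  have h0 : ((4 * 2 ^ a : ℝ) : ℂ) ≠ 0 := by
    have : (0 : ℝ) < 4 * 2 ^ a := by positivity
    exact_mod_cast this.ne'
  have hGint : Integrable fun ξ => (posPow a (1 / 2 - ‖ξ‖ ^ 2 / 2) : ℂ) * G ξ := by
    have h1 : IntegrableOn F (cayley ζ '' Metric.ball 0 1) := hint.integrableOn
    rw [integrableOn_image_iff_integrableOn_abs_det_fderiv_smul volume hball hder
      (injOn_cayley hζ)] at h1
    have h2 := (h1.congr_fun hpt hball).const_mul (((4 * 2 ^ a : ℝ) : ℂ)⁻¹)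
    simp only [inv_mul_cancel_left₀ h0] at h2
    exact (integrableOn_iff_integrable_of_support_subset
      (fun ξ hξ => by_contra fun hn => hξ (hGs ξ hn))).1 h2
  have hGd : DifferentiableOn ℂ G {ξ | 0 < 1 / 2 - ‖ξ‖ ^ 2 / 2} := by
    intro ξ hξ
    have hξb := (hset ξ).1 hξ
    have hξ' : ‖ξ‖ < 1 := by simpa using hξb
    have him : 0 < (cayley ζ ξ).im := by
      have : cayley ζ ξ ∈ cayley ζ '' Metric.ball 0 1 := mem_image_of_mem _ hξb
      rwa [image_cayley hζ] at this
    have hd1 : DifferentiableAt ℂ h (cayley ζ ξ) := (hh _ him).differentiableAt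
      ((isOpen_lt continuous_const Complex.continuous_im).mem_nhds him)
    refine DifferentiableAt.differentiableWithinAt ?_
    refine (hd1.comp ξ (hasDerivAt_cayley ζ hξ').differentiableAt).div ?_ ?_
    · exact ((differentiableAt_const _).sub differentiableAt_id).cpow_const
        (Or.inl (one_sub_re_pos hξ'))
    · rw [Complex.cpow_ne_zero_iff]
      exact Or.inl (one_sub_ne_zero hξ')
  calc ∫ u, F u = ∫ u in cayley ζ '' Metric.ball 0 1, F u := by
        rw [image_cayley hζ, setIntegral_eq_integral_of_forall_compl_eq_zero hFs]
    _ = ∫ ξ in Metric.ball (0 : ℂ) 1,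
          ((4 * 2 ^ a : ℝ) : ℂ) * ((posPow a (1 / 2 - ‖ξ‖ ^ 2 / 2) : ℂ) * G ξ) := by
        rw [integral_image_eq_integral_abs_det_fderiv_smul volume hball hder (injOn_cayley hζ)]
        exact setIntegral_congr_fun hball hpt
    _ = ((4 * 2 ^ a : ℝ) : ℂ) * ((2 * Real.pi / (a + 1) * posPow (a + 1) (1 / 2) : ℝ) * G 0) := by
        rw [integral_const_mul, setIntegral_eq_integral_of_forall_compl_eq_zero hGs,
          integral_disc_mean ha (1 / 2) hGd hGint]
    _ = _ := by
        have hG0 : G 0 = h ζ := by simp [hG, cayley]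
        have h2a : (2 : ℝ) ^ a ≠ 0 := (Real.rpow_pos_of_pos two_pos a).ne'
        have h5 : (4 : ℝ) * 2 ^ a * (2 * Real.pi / (a + 1) * posPow (a + 1) (1 / 2)) =
            4 * Real.pi / (a + 1) := by
          rw [posPow_of_pos (by norm_num), Real.div_rpow (by norm_num) (by norm_num),
            Real.one_rpow, Real.rpow_add two_pos, Real.rpow_one]
          field_simp
        rw [hG0, ← mul_assoc, ← Complex.ofReal_mul, h5]

/-! ### Siegel coordinates and the reproducing formula on the tube -/

theorem continuous_rho {n : ℕ} : Continuous (rho : Cn n → ℝ) := by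
  unfold rho
  fun_prop

theorem mem_tube_iff {n : ℕ} {z : Cn n} : z ∈ tube n ↔ 0 < rho z := by
  simp [tube, rho]

theorem isOpen_tube (n : ℕ) : IsOpen (tube n) := by
  have : tube n = {z | 0 < rho z} := by
    ext z
    exact mem_tube_iff
  rw [this]
  exact isOpen_lt continuous_const continuous_rho

/-- The biholomorphic, volume preserving map from the Siegel domain `{|v|²/2 < Im u}` onto `T_B`,
adapted to the point `z`: it takes `(0, ζ)` to `z` for `ζ = siegelPoint z`, and in these coordinates
`ρ(z, ·)` depends on the last variable alone. -/
def siegelMap {n : ℕ} (z p : Cn n) : Cn n :=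
  (fun j => p.1 j + z.1 j, p.2 - (Complex.I * (∑ j, ((z.1 j).im : ℂ) ^ 2) +
    Complex.I / 2 * ∑ j, (p.1 j + 2 * Complex.I * (z.1 j).im) ^ 2))

/-- The last Siegel coordinate of `z` in the coordinates adapted to `z`. -/
def siegelPoint {n : ℕ} (z : Cn n) : ℂ := z.2 - Complex.I * ∑ j, ((z.1 j).im : ℂ) ^ 2

theorem siegelPoint_im {n : ℕ} (z : Cn n) : (siegelPoint z).im = rho z := by
  have : (∑ j, ((z.1 j).im : ℂ) ^ 2) = ((∑ j, (z.1 j).im ^ 2 : ℝ) : ℂ) := by push_cast; rfl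
  rw [siegelPoint, rho, this, Complex.sub_im, Complex.I_mul_im, Complex.ofReal_re]

theorem siegelMap_siegelPoint {n : ℕ} (z : Cn n) : siegelMap z (0, siegelPoint z) = z := by
  refine Prod.ext ?_ ?_
  · funext j
    simp [siegelMap]
  · simp only [siegelMap, siegelPoint, Pi.zero_apply, zero_add, mul_pow, Complex.I_sq]
    rw [← Finset.mul_sum]
    ring

theorem rho_siegelMap {n : ℕ} (z p : Cn n) :
    rho (siegelMap z p) = p.2.im - (∑ j, ‖p.1 j‖ ^ 2) / 2 := by
  have h1 : (Complex.I * (∑ j, ((z.1 j).im : ℂ) ^ 2) +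
      Complex.I / 2 * ∑ j, (p.1 j + 2 * Complex.I * (z.1 j).im) ^ 2).im =
      ∑ j, ((z.1 j).im ^ 2 + ((p.1 j).re ^ 2 - ((p.1 j).im + 2 * (z.1 j).im) ^ 2) / 2) := by
    rw [Finset.mul_sum, Finset.mul_sum, ← Finset.sum_add_distrib, Complex.im_sum]
    refine Finset.sum_congr rfl fun j _ => ?_
    simp [pow_two]
    ring
  simp only [rho, siegelMap, Complex.sub_im]
  rw [h1, sub_sub, ← Finset.sum_add_distrib, Finset.sum_div]
  congr 1
  refine Finset.sum_congr rfl fun j _ => ?_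
  rw [← Complex.normSq_eq_norm_sq, Complex.normSq_apply, Complex.add_im]
  ring

theorem rhoPair_eq_halfPair {n : ℕ} (z w : Cn n) :
    rhoPair z w = halfPair
      (z.2 + Complex.I / 2 * ∑ j, (z.1 j - (starRingEnd ℂ) (w.1 j)) ^ 2) w.2 := by
  simp only [rhoPair, halfPair]
  linear_combination (1 / 4 * ∑ j, (z.1 j - (starRingEnd ℂ) (w.1 j)) ^ 2) * Complex.I_sq

theorem rhoPair_siegelMap {n : ℕ} (z p : Cn n) :
    rhoPair z (siegelMap z p) = halfPair (siegelPoint z) p.2 := by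
  have h1 : ∀ j, (z.1 j - (starRingEnd ℂ) (p.1 j + z.1 j)) ^ 2 =
      (starRingEnd ℂ) ((p.1 j + 2 * Complex.I * (z.1 j).im) ^ 2) := fun j => by
    have h3 : z.1 j - (starRingEnd ℂ) (z.1 j) = 2 * (z.1 j).im * Complex.I := by
      rw [Complex.sub_conj]
      push_cast
      ring
    rw [map_pow]
    simp only [map_add, map_mul, Complex.conj_I, Complex.conj_ofReal, map_ofNat]
    rw [show z.1 j - ((starRingEnd ℂ) (p.1 j) + (starRingEnd ℂ) (z.1 j)) =
      (z.1 j - (starRingEnd ℂ) (z.1 j)) - (starRingEnd ℂ) (p.1 j) by ring, h3]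
    ring
  have h2 : ∑ j, (z.1 j - (starRingEnd ℂ) ((siegelMap z p).1 j)) ^ 2 =
      (starRingEnd ℂ) (∑ j, (p.1 j + 2 * Complex.I * (z.1 j).im) ^ 2) := by
    rw [map_sum]
    exact Finset.sum_congr rfl fun j _ => h1 j
  have h3 : (starRingEnd ℂ) (∑ j, ((z.1 j).im : ℂ) ^ 2) = ∑ j, ((z.1 j).im : ℂ) ^ 2 := by
    simp only [map_sum, map_pow, Complex.conj_ofReal]
  rw [rhoPair_eq_halfPair, h2]
  simp only [siegelMap, siegelPoint, halfPair, map_sub, map_add, map_mul, map_div₀,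
    Complex.conj_I, map_ofNat, h3]
  ring

theorem differentiable_siegelMap {n : ℕ} (z : Cn n) : Differentiable ℂ (siegelMap z) := by
  unfold siegelMap
  fun_prop

theorem injective_siegelMap {n : ℕ} (z : Cn n) : Function.Injective (siegelMap z) := by
  intro p q h
  have h1 : p.1 = q.1 := by
    funext j
    have := congrFun (congrArg Prod.fst h) j
    simpa [siegelMap] using this
  refine Prod.ext h1 ?_
  have h2 := congrArg Prod.snd h
  simp only [siegelMap, h1] at h2
  exact sub_left_injective h2

theorem measurableEmbedding_siegelMap {n : ℕ} (z : Cn n) : MeasurableEmbedding (siegelMap z) :=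
  (differentiable_siegelMap z).continuous.measurableEmbedding (injective_siegelMap z)

theorem measurePreserving_siegelMap {n : ℕ} (z : Cn n) :
    MeasurePreserving (siegelMap z) volume volume := by
  have h1 : MeasurePreserving (fun v : Fin (n - 1) → ℂ => v + z.1) volume volume :=
    measurePreserving_add_right volume z.1
  refine h1.skew_product (g := fun (v : Fin (n - 1) → ℂ) (u : ℂ) => (siegelMap z (v, u)).2) ?_ ?_
  · exact ((differentiable_siegelMap z).continuous.measurable).snd
  · exact Filter.Eventually.of_forall fun v =>
      (measurePreserving_sub_right volume (Complex.I * (∑ j, ((z.1 j).im : ℂ) ^ 2) +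
        Complex.I / 2 * ∑ j, (v j + 2 * Complex.I * (z.1 j).im) ^ 2)).map_eq

/-- Extended by zero, the integrand of `T α` carries the truncated power of `ρ` as its weight. -/
theorem indicator_integrand {n : ℕ} (α : ℝ) (f : Cn n → ℂ) (z : Cn n) :
    (tube n).indicator (integrand α f z) = fun w =>
      (posPow α (rho w) : ℂ) * (f w / rhoPair z w ^ ((n + 1 + α : ℝ) : ℂ)) := by
  funext w
  by_cases hw : w ∈ tube n
  · rw [indicator_of_mem hw, integrand, posPow_of_pos (mem_tube_iff.1 hw)]
    ring
  · rw [indicator_of_notMem hw, posPow_of_nonpos (not_lt.1 (mt mem_tube_iff.2 hw))]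
    simp

theorem differentiableOn_comp_siegelMap {n : ℕ} (z : Cn n) {f : Cn n → ℂ}
    (hf : DifferentiableOn ℂ f (tube n)) :
    DifferentiableOn ℂ (fun p => f (siegelMap z p)) {p | 0 < p.2.im - (∑ j, ‖p.1 j‖ ^ 2) / 2} :=
  hf.comp (differentiable_siegelMap z).differentiableOn fun p hp => by
    rw [mem_tube_iff, rho_siegelMap]
    exact hp

/-- The reproducing formula without derivatives, for any holomorphic `f` for which the integral
converges absolutely.  In the coordinates adapted to `z`, the mean value property removes the first
`n - 1` variables, and the formula on the upper half-plane with exponent `α + n - 1` the last. -/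
theorem integral_reproducing {n : ℕ} (hn : 1 ≤ n) {α : ℝ} (hα : -1 < α) {f : Cn n → ℂ}
    (hf : DifferentiableOn ℂ f (tube n)) {z : Cn n} (hz : z ∈ tube n)
    (hint : IntegrableOn (integrand α f z) (tube n)) :
    ∫ w in tube n, integrand α f z w =
      (2 ^ (n + 1) * Real.pi ^ n * Real.Gamma (α + 1) / Real.Gamma (n + 1 + α) : ℝ) * f z := by
  have hmn : ((n - 1 : ℕ) : ℝ) = n - 1 := by
    rw [Nat.cast_sub hn, Nat.cast_one]
  have hn' : (1 : ℝ) ≤ n := by exact_mod_cast hn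
  have hζ : 0 < (siegelPoint z).im := by
    rw [siegelPoint_im]
    exact mem_tube_iff.1 hz
  set ζ := siegelPoint z with hζdef
  have hs : (n + 1 + α : ℝ) = 2 + (α + ((n - 1 : ℕ) : ℝ)) := by
    rw [hmn]
    ring
  have ha : -1 < α + ((n - 1 : ℕ) : ℝ) := by
    rw [hmn]
    linarith
  have hmeas := (isOpen_tube n).measurableSet
  have hmp := measurePreserving_siegelMap z
  have hemb := measurableEmbedding_siegelMap z
  have hgd := differentiableOn_comp_siegelMap z hf
  set g : Cn n → ℂ := fun p => f (siegelMap z p) with hg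
  rw [← integrable_indicator_iff hmeas, indicator_integrand,
    ← hmp.integrable_comp_emb hemb, Measure.volume_eq_prod] at hint
  rw [← integral_indicator hmeas, indicator_integrand, ← hmp.integral_comp hemb,
    Measure.volume_eq_prod]
  simp only [Function.comp_def, rho_siegelMap, rhoPair_siegelMap, hs, ← hζdef] at hint ⊢
  set K : ℂ → ℂ := fun u => halfPair ζ u ^ ((2 + (α + ((n - 1 : ℕ) : ℝ)) : ℝ) : ℂ) with hK
  have hslice : ∀ᵐ u : ℂ, ∫ v : Fin (n - 1) → ℂ,
      (posPow α (u.im - (∑ j, ‖v j‖ ^ 2) / 2) : ℂ) * (g (v, u) / K u) =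
      (ballConst (n - 1) α : ℂ) *
        ((posPow (α + ((n - 1 : ℕ) : ℝ)) u.im : ℂ) * (g (0, u) / K u)) := by
    filter_upwards [hint.prod_left_ae] with u hu
    rw [integral_ball_mean (n - 1) hα u.im (h := fun v => g (v, u) / K u) ?_ hu]
    · push_cast
      ring
    · have hd : Differentiable ℂ fun v : Fin (n - 1) → ℂ => ((v, u) : Cn n) :=
        differentiable_id.prodMk (differentiable_const u)
      have hc : DifferentiableOn ℂ (fun v => g (v, u)) {v | 0 < u.im - (∑ j, ‖v j‖ ^ 2) / 2} :=
        hgd.comp hd.differentiableOn fun v hv => hv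
      simpa only [div_eq_mul_inv] using hc.mul_const (K u)⁻¹
  have hb := ballConst_pos (n - 1) hα
  have hmarg : Integrable fun u : ℂ =>
      (posPow (α + ((n - 1 : ℕ) : ℝ)) u.im : ℂ) * (g (0, u) / K u) := by
    have hne : (ballConst (n - 1) α : ℂ) ≠ 0 := by exact_mod_cast hb.ne'
    refine ((hint.integral_prod_right.congr hslice).const_mul
      ((ballConst (n - 1) α : ℂ)⁻¹)).congr (Filter.Eventually.of_forall fun u => ?_)
    show _⁻¹ * (_ * _) = _
    rw [inv_mul_cancel_left₀ hne]
  have hg0 : DifferentiableOn ℂ (fun u => g (0, u)) {u | 0 < u.im} := by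
    refine hgd.comp ((differentiable_const _).prodMk differentiable_id).differentiableOn
      fun u hu => ?_
    simpa using hu
  have hgz : g (0, ζ) = f z := by
    simp only [hg, hζdef, siegelMap_siegelPoint]
  rw [integral_prod_symm _ hint]
  calc _ = _ := integral_congr_ae hslice
    _ = (ballConst (n - 1) α : ℂ) *
        ((4 * Real.pi / (α + ((n - 1 : ℕ) : ℝ) + 1) : ℝ) * g (0, ζ)) := by
      rw [integral_const_mul, integral_halfPlane_reproducing ha hζ hg0 hmarg]
    _ = _ := by
      rw [hgz, ← mul_assoc, ← Complex.ofReal_mul]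
      congr 2
      have hΓ : Real.Gamma (2 + (α + (n - 1))) = (n + α) * Real.Gamma (α + (n - 1) + 1) := by
        rw [show (2 + (α + (n - 1)) : ℝ) = (n + α) + 1 by ring, Real.Gamma_add_one (by linarith)]
        ring_nf
      have hpos : 0 < Real.Gamma (α + (n - 1) + 1) := Real.Gamma_pos_of_pos (by linarith)
      have h0 : (n + α : ℝ) ≠ 0 := by linarith
      obtain ⟨m, rfl⟩ : ∃ m, n = m + 1 := ⟨n - 1, by omega⟩
      rw [ballConst, hmn, hΓ, show α + (((m + 1 : ℕ) : ℝ) - 1) + 1 = (m + 1 : ℕ) + α by ring]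
      rw [show α + (((m + 1 : ℕ) : ℝ) - 1) + 1 = (m + 1 : ℕ) + α by ring] at hpos
      simp only [Nat.add_sub_cancel]
      field_simp
      ring

/-! ### Absolute convergence on the Bergman space -/

/-- The point `ζ` with `ρ(z, (w', u)) = halfPair ζ u` for all `u`, when `z` and `w'` are fixed. -/
def fiberPoint {n : ℕ} (z : Cn n) (w' : Fin (n - 1) → ℂ) : ℂ :=
  z.2 + Complex.I / 2 * ∑ j, (z.1 j - (starRingEnd ℂ) (w' j)) ^ 2

theorem rhoPair_eq_halfPair_fiberPoint {n : ℕ} (z : Cn n) (w' : Fin (n - 1) → ℂ) (u : ℂ) :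
    rhoPair z (w', u) = halfPair (fiberPoint z w') u :=
  rhoPair_eq_halfPair z (w', u)

theorem rho_sub_le_fiberPoint_im {n : ℕ} (z : Cn n) (w' : Fin (n - 1) → ℂ) :
    rho z - ∑ j, (w' j).im ^ 2 ≤ (fiberPoint z w').im := by
  have h1 : (Complex.I / 2 * ∑ j, (z.1 j - (starRingEnd ℂ) (w' j)) ^ 2).im =
      ∑ j, (((z.1 j).re - (w' j).re) ^ 2 - ((z.1 j).im + (w' j).im) ^ 2) / 2 := by
    rw [Finset.mul_sum, Complex.im_sum]
    refine Finset.sum_congr rfl fun j _ => ?_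
    simp [pow_two]
    ring
  have h2 : -(∑ j, (z.1 j).im ^ 2) - ∑ j, (w' j).im ^ 2 ≤
      ∑ j, (((z.1 j).re - (w' j).re) ^ 2 - ((z.1 j).im + (w' j).im) ^ 2) / 2 := by
    rw [← Finset.sum_neg_distrib, ← Finset.sum_sub_distrib]
    refine Finset.sum_le_sum fun j _ => ?_
    nlinarith [sq_nonneg ((z.1 j).re - (w' j).re), sq_nonneg ((z.1 j).im - (w' j).im)]
  rw [fiberPoint, Complex.add_im, h1, rho]
  linarith

theorem rho_add_rho_le_norm_rhoPair {n : ℕ} (z w : Cn n) :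
    (rho z + rho w) / 2 ≤ ‖rhoPair z w‖ := by
  have h1 := rho_sub_le_fiberPoint_im z w.1
  have h2 := re_le_norm_halfPair (fiberPoint z w.1) w.2
  rw [← rhoPair_eq_halfPair_fiberPoint] at h2
  refine le_trans ?_ h2
  rw [rho, rho] at *
  linarith

theorem continuous_rhoPair {n : ℕ} (z : Cn n) : Continuous (rhoPair z) := by
  unfold rhoPair
  have h : Continuous fun w : Cn n => (starRingEnd ℂ) w.2 :=
    Complex.continuous_conj.comp continuous_snd
  have h' : ∀ j, Continuous fun w : Cn n => (starRingEnd ℂ) (w.1 j) := fun j =>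
    Complex.continuous_conj.comp (by fun_prop)
  fun_prop

theorem integrable_posPow_mul_rpow {c b : ℝ} (hc : -1 < c) (hb : c + 1 < b) :
    Integrable fun y => posPow c y * (1 + |y|) ^ (-b) := by
  have hb0 : 0 < b := by linarith
  have hm : Measurable fun y : ℝ => posPow c y * (1 + |y|) ^ (-b) :=
    (measurable_posPow c).mul ((measurable_const.add (by fun_prop)).pow_const _)
  have h1 : IntegrableOn (fun y => posPow c y * (1 + |y|) ^ (-b)) (Iic 0) :=
    integrableOn_zero.congr_fun (fun y hy => by simp [posPow_of_nonpos (show y ≤ 0 from hy)])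
      measurableSet_Iic
  have h2 : IntegrableOn (fun y => posPow c y * (1 + |y|) ^ (-b)) (Ioc 0 1) := by
    have := (intervalIntegrable_iff_integrableOn_Ioc_of_le zero_le_one).1
      (intervalIntegral.intervalIntegrable_rpow' (a := 0) (b := 1) hc)
    refine Integrable.mono' this hm.aestronglyMeasurable
      ((ae_restrict_iff' measurableSet_Ioc).2 (Filter.Eventually.of_forall fun y hy => ?_))
    rw [Real.norm_of_nonneg (mul_nonneg (posPow_nonneg _ _) (by positivity)), posPow_of_pos hy.1]
    exact mul_le_of_le_one_right (Real.rpow_nonneg hy.1.le _)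
      (Real.rpow_le_one_of_one_le_of_nonpos (by linarith [abs_nonneg y]) (by linarith))
  have h3 : IntegrableOn (fun y => posPow c y * (1 + |y|) ^ (-b)) (Ioi 1) := by
    have := integrableOn_Ioi_rpow_of_lt (show c - b < -1 by linarith) zero_lt_one
    refine Integrable.mono' this hm.aestronglyMeasurable
      ((ae_restrict_iff' measurableSet_Ioi).2 (Filter.Eventually.of_forall fun y hy => ?_))
    have hy0 : 0 < y := zero_lt_one.trans hy
    rw [Real.norm_of_nonneg (mul_nonneg (posPow_nonneg _ _) (by positivity)), posPow_of_pos hy0,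
      sub_eq_add_neg, Real.rpow_add hy0, abs_of_pos hy0]
    exact mul_le_mul_of_nonneg_left (Real.rpow_le_rpow_of_nonpos hy0 (by linarith) (by linarith))
      (Real.rpow_nonneg hy0.le _)
  rw [← integrableOn_univ, ← Iic_union_Ioi (a := (0 : ℝ)), ← Ioc_union_Ioi_eq_Ioi zero_le_one]
  exact h1.union (h2.union h3)

theorem integrable_halfPlane_kernel {c b : ℝ} (hc : -1 < c) (hb : c + 2 < b) {ζ : ℂ}
    (hζ : 0 < ζ.im) :
    Integrable fun u : ℂ => posPow c u.im * ‖halfPair ζ u‖ ^ (-b) := by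
  -- The exponent `b` is split as `b₁ + b₂` with `b₁ > 1` for `Re u` and `b₂ > c + 1` for `Im u`.
  set δ := (b - c - 2) / 2 with hδ
  have hδ0 : 0 < δ := by rw [hδ]; linarith
  set M := 2 * (1 / ζ.im + 1) with hM
  have hM0 : 0 < M := by positivity
  have h1 : Integrable fun x : ℝ => (1 + ‖x - ζ.re‖) ^ (-(1 + δ)) :=
    (integrable_one_add_norm (μ := (volume : Measure ℝ)) (r := 1 + δ)
      (by simpa using hδ0)).comp_sub_right ζ.re
  have h2 : Integrable fun y => posPow c y * (1 + |y|) ^ (-(c + 1 + δ)) :=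
    integrable_posPow_mul_rpow hc (by linarith)
  have h3 := (h1.mul_prod h2)
  rw [← Measure.volume_eq_prod, ← Complex.volume_preserving_equiv_real_prod.integrable_comp_emb
    (MeasurableEquiv.measurableEmbedding _)] at h3
  refine (h3.const_mul (M ^ b)).mono' ?_ (Filter.Eventually.of_forall fun u => ?_)
  · exact (((measurable_posPow c).comp Complex.measurable_im).mul
      ((continuous_halfPair ζ).measurable.norm.pow_const _)).aestronglyMeasurable
  rw [Real.norm_of_nonneg (mul_nonneg (posPow_nonneg _ _) (by positivity))]
  simp only [Function.comp_apply, Complex.measurableEquivRealProd_apply]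
  rcases le_or_gt u.im 0 with hu | hu
  · simp [posPow_of_nonpos hu]
  have hA := re_le_norm_halfPair ζ u
  have hB : |u.re - ζ.re| / 2 ≤ ‖halfPair ζ u‖ := by
    have h4 : (halfPair ζ u).im = -(ζ.re - u.re) / 2 := by
      simp [halfPair]
      ring
    have := Complex.abs_im_le_norm (halfPair ζ u)
    rw [h4, abs_div, abs_neg, abs_sub_comm] at this
    simpa using this
  set A := ‖halfPair ζ u‖ with hAdef
  have hA0 : 0 < A := by linarith
  have hone : 1 ≤ 1 / ζ.im * (2 * A) := by
    rw [one_div, ← div_eq_inv_mul, le_div_iff₀ hζ]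
    linarith
  have hM1 : 1 + |u.re - ζ.re| ≤ M * A := by
    rw [hM]
    nlinarith
  have hM2 : 1 + |u.im| ≤ M * A := by
    rw [hM, abs_of_pos hu]
    nlinarith
  have hsplit : A ^ (-b) = M ^ b * ((M * A) ^ (-(1 + δ)) * (M * A) ^ (-(c + 1 + δ))) := by
    have hb' : -(1 + δ) + -(c + 1 + δ) = -b := by
      rw [hδ]
      ring
    rw [← Real.rpow_add (by positivity), hb', Real.mul_rpow hM0.le hA0.le, ← mul_assoc,
      ← Real.rpow_add hM0, add_neg_cancel, Real.rpow_zero, one_mul]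
  rw [hsplit]
  have k1 := Real.rpow_le_rpow_of_nonpos (z := -(1 + δ)) (by positivity) hM1 (by linarith)
  have k2 := Real.rpow_le_rpow_of_nonpos (z := -(c + 1 + δ)) (by positivity) hM2 (by linarith)
  have hp := posPow_nonneg c u.im
  calc posPow c u.im * (M ^ b * ((M * A) ^ (-(1 + δ)) * (M * A) ^ (-(c + 1 + δ))))
      ≤ posPow c u.im * (M ^ b * ((1 + |u.re - ζ.re|) ^ (-(1 + δ)) *
          (1 + |u.im|) ^ (-(c + 1 + δ)))) := by gcongr
    _ = _ := by
      rw [Real.norm_eq_abs]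
      ring

/-- The powers of `ρ(z, ·)` that are integrable against `ρᵃ`. -/
theorem integrable_kernel {n : ℕ} (hn : 1 ≤ n) {a b : ℝ} (ha : -1 < a) (hb : n + 1 + a < b)
    {z : Cn n} (hz : z ∈ tube n) :
    Integrable fun w : Cn n => posPow a (rho w) * ‖rhoPair z w‖ ^ (-b) := by
  have hmn : ((n - 1 : ℕ) : ℝ) = n - 1 := by
    rw [Nat.cast_sub hn, Nat.cast_one]
  have hn' : (1 : ℝ) ≤ n := by exact_mod_cast hn
  have hζ : 0 < (siegelPoint z).im := by
    rw [siegelPoint_im]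
    exact mem_tube_iff.1 hz
  have hm1 : Measurable fun w : Cn n => posPow a (rho w) * ‖rhoPair z w‖ ^ (-b) :=
    ((measurable_posPow a).comp continuous_rho.measurable).mul
      ((continuous_rhoPair z).measurable.norm.pow_const _)
  refine ⟨hm1.aestronglyMeasurable, ?_⟩
  rw [hasFiniteIntegral_iff_ofReal (Filter.Eventually.of_forall fun w =>
    mul_nonneg (posPow_nonneg _ _) (by positivity)),
    ← (measurePreserving_siegelMap z).lintegral_comp_emb (measurableEmbedding_siegelMap z),
    Measure.volume_eq_prod]
  have hm3 : Measurable fun p : Cn n => ENNReal.ofReal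
      (posPow a (rho (siegelMap z p)) * ‖rhoPair z (siegelMap z p)‖ ^ (-b)) :=
    (hm1.comp (measurableEmbedding_siegelMap z).measurable).ennreal_ofReal
  rw [lintegral_prod_symm' _ hm3]
  have hk := (integrable_halfPlane_kernel (c := a + ((n - 1 : ℕ) : ℝ)) (b := b)
    (by rw [hmn]; linarith) (by rw [hmn]; linarith) hζ).const_mul (ballConst (n - 1) a)
  refine lt_of_eq_of_lt (lintegral_congr fun u => ?_) hk.lintegral_lt_top
  have hm2 : Measurable fun v : Fin (n - 1) → ℂ =>
      ENNReal.ofReal (posPow a (u.im - (∑ j, ‖v j‖ ^ 2) / 2)) :=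
    ((measurable_posPow a).comp (by fun_prop)).ennreal_ofReal
  simp only [rho_siegelMap, rhoPair_siegelMap, ENNReal.ofReal_mul (posPow_nonneg _ _)]
  rw [lintegral_mul_const _ hm2, lintegral_ball (n - 1) ha, ← mul_assoc,
    ENNReal.ofReal_mul (mul_nonneg (ballConst_pos (n - 1) ha).le (posPow_nonneg _ _))]

theorem measurable_rho_rpow {n : ℕ} (a : ℝ) : Measurable fun w : Cn n => rho w ^ a :=
  continuous_rho.measurable.pow_const _

theorem ae_weightedVolume_of_forall_mem_tube {n : ℕ} {lam : ℝ} {P : Cn n → Prop}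
    (h : ∀ w ∈ tube n, P w) : ∀ᵐ w ∂weightedVolume n lam, P w :=
  (withDensity_absolutelyContinuous _ _).ae_le
    ((ae_restrict_iff' (isOpen_tube n).measurableSet).2 (Filter.Eventually.of_forall h))

theorem integrable_weightedVolume_iff {n : ℕ} {lam : ℝ} {E : Type*} [NormedAddCommGroup E]
    [NormedSpace ℝ E] {g : Cn n → E} :
    Integrable g (weightedVolume n lam) ↔ IntegrableOn (fun w => rho w ^ lam • g w) (tube n) := by
  rw [weightedVolume, integrable_withDensity_iff_integrable_smul'
    (measurable_rho_rpow lam).ennreal_ofReal (Filter.Eventually.of_forall fun _ =>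
      ENNReal.ofReal_lt_top)]
  refine integrableOn_congr_fun (fun w hw => ?_) (isOpen_tube n).measurableSet
  rw [ENNReal.toReal_ofReal (Real.rpow_nonneg (mem_tube_iff.1 hw).le _)]

theorem rhoPair_ne_zero {n : ℕ} {z w : Cn n} (hz : z ∈ tube n) (hw : w ∈ tube n) :
    rhoPair z w ≠ 0 := fun h => by
  have := rhoPair_re_pos hz hw
  rw [h] at this
  simp at this

/-- The kernel of `T α`, as a density with respect to `weightedVolume n lam`, lies in the dual of
the Lebesgue space of exponent `p`. -/
theorem exists_memLp_kernel {n : ℕ} (hn : 1 ≤ n) {p lam α : ℝ} (hp : 1 ≤ p) (hlam : -1 < lam)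
    (hα_gt : 1 < p → (lam + 1) / p - 1 < α) (hα_ge : p = 1 → lam ≤ α) {z : Cn n}
    (hz : z ∈ tube n) :
    ∃ q : ENNReal, ENNReal.HolderConjugate (ENNReal.ofReal p) q ∧
      MemLp (fun w => ((rho w ^ (α - lam) : ℝ) : ℂ) / rhoPair z w ^ ((n + 1 + α : ℝ) : ℂ)) q
        (weightedVolume n lam) := by
  have hn' : (1 : ℝ) ≤ n := by exact_mod_cast hn
  have hmeas := (isOpen_tube n).measurableSet
  set k : Cn n → ℂ := fun w =>
    ((rho w ^ (α - lam) : ℝ) : ℂ) / rhoPair z w ^ ((n + 1 + α : ℝ) : ℂ) with hk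
  have hkm : AEStronglyMeasurable k (weightedVolume n lam) := by
    refine (Measurable.aestronglyMeasurable ?_)
    exact (Complex.measurable_ofReal.comp (measurable_rho_rpow _)).div
      ((continuous_rhoPair z).measurable.pow_const _)
  have hnorm : ∀ w ∈ tube n, ‖k w‖ = rho w ^ (α - lam) * ‖rhoPair z w‖ ^ (-(n + 1 + α)) :=
    fun w hw => by
      have hr := Real.rpow_nonneg (mem_tube_iff.1 hw).le (α - lam)
      rw [hk]
      simp only []
      rw [norm_div, Complex.norm_cpow_real, Complex.norm_of_nonneg hr,
        Real.rpow_neg (norm_nonneg _), div_eq_mul_inv]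
  have hρz := mem_tube_iff.1 hz
  rcases hp.eq_or_lt with hp1 | hp1
  · -- Here `2|ρ(z, w)|` bounds both `ρ(w)` and `ρ(z)`, so that the kernel is bounded.
    subst hp1
    have hα := hα_ge rfl
    refine ⟨⊤, by rw [ENNReal.ofReal_one]; infer_instance, memLp_top_of_bound hkm
      (2 ^ (α - lam) * (rho z / 2) ^ (-(n + 1 + lam))) (ae_weightedVolume_of_forall_mem_tube
        fun w hw => ?_)⟩
    have hρw := mem_tube_iff.1 hw
    have hA := rho_add_rho_le_norm_rhoPair z w
    rw [hnorm w hw]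
    set A := ‖rhoPair z w‖
    have hA0 : 0 < A := by linarith
    have e1 : rho w ^ (α - lam) ≤ (2 * A) ^ (α - lam) :=
      Real.rpow_le_rpow hρw.le (by linarith) (by linarith)
    have e2 : A ^ (-(n + 1 + lam)) ≤ (rho z / 2) ^ (-(n + 1 + lam)) :=
      Real.rpow_le_rpow_of_nonpos (by linarith) (by linarith) (by linarith)
    calc rho w ^ (α - lam) * A ^ (-(n + 1 + α))
        ≤ (2 * A) ^ (α - lam) * A ^ (-(n + 1 + α)) := by gcongr
      _ = 2 ^ (α - lam) * A ^ (-(n + 1 + lam)) := by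
        rw [Real.mul_rpow two_pos.le hA0.le, mul_assoc, ← Real.rpow_add hA0]
        ring_nf
      _ ≤ _ := by gcongr
  · -- For the conjugate exponent `q`, the integral of `|kernel|^q ρ^lam` has the form treated in
    -- `integrable_kernel`: its condition at the boundary is the hypothesis on `α`, and its
    -- condition at infinity amounts to `n + 1 + lam > 0`.
    have hα := hα_gt hp1
    have hp0 : 0 < p := by linarith
    have hpq := Real.HolderConjugate.conjExponent hp1
    set q := p.conjExponent with hq
    have hq0 : 0 < q := hpq.symm.pos
    have hq1 : 1 < q := hpq.symm.lt
    have hpq' : q * (p - 1) = p := by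
      rw [hq, Real.conjExponent]
      have : p - 1 ≠ 0 := by linarith
      field_simp
    have hα' : lam + 1 - p < α * p := by
      have : (lam + 1) / p < α + 1 := by linarith
      rw [div_lt_iff₀ hp0] at this
      linarith
    have ha : -1 < (α - lam) * q + lam := by
      have hp1' : 0 < p - 1 := by linarith
      have : 0 < ((α - lam) * q + lam + 1) * (p - 1) := by
        have : ((α - lam) * q + lam + 1) * (p - 1) =
          (α - lam) * (q * (p - 1)) + (lam + 1) * (p - 1) := by ring
        rw [this, hpq']
        nlinarith
      have := pos_of_mul_pos_left this hp1'.le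
      linarith
    have hb : n + 1 + ((α - lam) * q + lam) < (n + 1 + α) * q := by
      nlinarith
    refine ⟨ENNReal.ofReal q, hpq.ennrealOfReal, ?_⟩
    rw [← integrable_norm_rpow_iff hkm (by simpa using hq0) ENNReal.ofReal_ne_top,
      integrable_weightedVolume_iff, ENNReal.toReal_ofReal hq0.le]
    refine ((integrable_kernel hn ha hb hz).integrableOn (s := tube n)).congr_fun
      (fun w hw => ?_) hmeas
    have hρw := mem_tube_iff.1 hw
    simp only [smul_eq_mul]
    rw [hnorm w hw, posPow_of_pos hρw, Real.mul_rpow (by positivity) (by positivity),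
      ← Real.rpow_mul hρw.le, ← Real.rpow_mul (norm_nonneg _), ← mul_assoc, ← Real.rpow_add hρw]
    ring_nf

/-- The integral `T α f z` converges absolutely for `f` in the Bergman space. -/
theorem integrableOn_integrand {n : ℕ} (hn : 1 ≤ n) {p lam α : ℝ} (hp : 1 ≤ p) (hlam : -1 < lam)
    (hα_gt : 1 < p → (lam + 1) / p - 1 < α) (hα_ge : p = 1 → lam ≤ α) {f : Cn n → ℂ}
    (hf : MemBergman n p lam f) {z : Cn n} (hz : z ∈ tube n) :
    IntegrableOn (integrand α f z) (tube n) := by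
  obtain ⟨q, hq, hk⟩ := exists_memLp_kernel hn hp hlam hα_gt hα_ge hz
  have h := hf.2.integrable_mul hk
  rw [integrable_weightedVolume_iff] at h
  refine h.congr_fun (fun w hw => ?_) (isOpen_tube n).measurableSet
  have hρw := mem_tube_iff.1 hw
  have h1 : rho w ^ α = rho w ^ lam * rho w ^ (α - lam) := by
    rw [← Real.rpow_add hρw]
    ring_nf
  simp only [integrand, Pi.mul_apply, Complex.real_smul, h1]
  push_cast
  ring

/-! ### Derivative estimates on half-planes -/

/-- The integrand `(Im u - c)₊^β h(u) / halfPair ζ u ^ s` on the half-plane `{Im u > c}`, extended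
by zero.  On each fibre of `T_B` over `w'` the integrals of the theorem take this form. -/
def fiberIntegrand (c : ℝ) (ζ : ℂ) (β s : ℝ) (h : ℂ → ℂ) (u : ℂ) : ℂ :=
  (posPow β (u.im - c) : ℂ) * (h u / halfPair ζ u ^ (s : ℂ))

theorem isOpen_halfPlane (c : ℝ) : IsOpen {u : ℂ | 0 < u.im - c} :=
  isOpen_lt continuous_const (by fun_prop)

theorem halfPair_re_pos {c : ℝ} {ζ u : ℂ} (hζ : 0 < ζ.im + c) (hu : 0 < u.im - c) :
    0 < (halfPair ζ u).re := by
  rw [halfPair_re]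
  linarith

theorem sub_le_two_mul_norm_halfPair {c : ℝ} {ζ : ℂ} (hζ : 0 < ζ.im + c) (u : ℂ) :
    u.im - c ≤ 2 * ‖halfPair ζ u‖ := by
  have := re_le_norm_halfPair ζ u
  linarith

theorem measurable_fiberIntegrand {c : ℝ} {ζ : ℂ} (hζ : 0 < ζ.im + c) (β s : ℝ) {h : ℂ → ℂ}
    (hh : ContinuousOn h {u | 0 < u.im - c}) : Measurable (fiberIntegrand c ζ β s h) := by
  refine measurable_posPow_mul (φ := fun u : ℂ => u.im - c) (by fun_prop) (hh.div ?_ ?_) β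
  · exact ((continuous_halfPair ζ).continuousOn).cpow_const fun u hu =>
      Or.inl (halfPair_re_pos hζ hu)
  · intro u hu h0
    have h1 := halfPair_re_pos hζ hu
    rw [(Complex.cpow_eq_zero_iff _ _).1 h0 |>.1] at h1
    simp at h1

theorem norm_fiberIntegrand (c : ℝ) (ζ : ℂ) (β s : ℝ) (h : ℂ → ℂ) (u : ℂ) :
    ‖fiberIntegrand c ζ β s h u‖ =
      posPow β (u.im - c) * ‖halfPair ζ u‖ ^ (-s) * ‖h u‖ := by
  rw [fiberIntegrand, norm_mul, norm_div, Complex.norm_cpow_real,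
    Complex.norm_of_nonneg (posPow_nonneg _ _), Real.rpow_neg (norm_nonneg _)]
  ring

theorem rpow_le_of_comparable {x x' : ℝ} (hx : 0 < x) (hx' : 0 < x') (h : x ≤ 2 * x')
    (h' : x' ≤ 2 * x) (β : ℝ) : x ^ β ≤ 2 ^ |β| * x' ^ β := by
  rcases le_or_gt 0 β with hβ | hβ
  · rw [abs_of_nonneg hβ, ← Real.mul_rpow two_pos.le hx'.le]
    exact Real.rpow_le_rpow hx.le h hβ
  · have : (2 : ℝ) ^ |β| * x' ^ β = (x' / 2) ^ β := by
      rw [abs_of_neg hβ, Real.rpow_neg two_pos.le, Real.div_rpow hx'.le two_pos.le]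
      ring
    rw [this]
    exact Real.rpow_le_rpow_of_nonpos (by positivity) (by linarith) hβ.le

theorem enorm_deriv_le_lintegral_circle {c : ℝ} {h : ℂ → ℂ}
    (hh : DifferentiableOn ℂ h {u | 0 < u.im - c}) {u : ℂ} (hu : 0 < u.im - c) :
    ‖deriv h u‖ₑ ≤ ENNReal.ofReal (1 / (u.im - c)) *
      ∫⁻ θ in Ioc 0 (2 * Real.pi), ‖h (circleMap u ((u.im - c) / 2) θ)‖ₑ := by
  set r := (u.im - c) / 2 with hr
  have hr0 : 0 < r := by positivity
  have hsub : Metric.closedBall u r ⊆ {u | 0 < u.im - c} := fun v hv => by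
    have h1 : ‖v - u‖ ≤ r := by simpa [dist_eq_norm] using hv
    have h2 := (abs_le.1 ((Complex.abs_im_le_norm (v - u)).trans h1)).1
    rw [Complex.sub_im] at h2
    show 0 < v.im - c
    linarith
  rw [← Complex.cderiv_eq_deriv (isOpen_halfPlane c) hh hr0 hsub, Complex.cderiv,
    circleIntegral, intervalIntegral.integral_of_le (by positivity), enorm_smul]
  have hpt : ∀ θ : ℝ, ‖deriv (circleMap u r) θ • ((circleMap u r θ - u) ^ 2)⁻¹ •
      h (circleMap u r θ)‖ₑ = ENNReal.ofReal r⁻¹ * ‖h (circleMap u r θ)‖ₑ := fun θ => by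
    rw [enorm_smul, enorm_smul, ← mul_assoc, ← enorm_mul, ← ofReal_norm]
    congr 2
    rw [norm_mul, norm_inv, norm_pow, deriv_circleMap, circleMap_sub_center, norm_mul]
    simp only [circleMap, zero_add, norm_mul, Complex.norm_real, Complex.norm_exp_ofReal_mul_I,
      Complex.norm_I, Real.norm_of_nonneg hr0.le]
    field_simp
  have hc : ‖(2 * (Real.pi : ℂ) * Complex.I)⁻¹‖ₑ = ENNReal.ofReal ((2 * Real.pi)⁻¹) := by
    rw [← ofReal_norm]
    simp [abs_of_pos Real.pi_pos]
  have hle : (2 * Real.pi)⁻¹ * r⁻¹ ≤ 1 / (u.im - c) := by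
    have h3 := Real.pi_gt_three
    rw [hr, ← mul_inv, one_div]
    refine inv_anti₀ hu ?_
    nlinarith
  calc _ ≤ ENNReal.ofReal ((2 * Real.pi)⁻¹) * ∫⁻ θ in Ioc 0 (2 * Real.pi),
        ENNReal.ofReal r⁻¹ * ‖h (circleMap u r θ)‖ₑ := by
        rw [hc]
        gcongr
        refine (enorm_integral_le_lintegral_enorm _).trans_eq (lintegral_congr hpt)
    _ = ENNReal.ofReal ((2 * Real.pi)⁻¹ * r⁻¹) *
        ∫⁻ θ in Ioc 0 (2 * Real.pi), ‖h (circleMap u r θ)‖ₑ := by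
        rw [lintegral_const_mul' _ _ ENNReal.ofReal_ne_top, ← mul_assoc,
          ← ENNReal.ofReal_mul (by positivity)]
    _ ≤ _ := by gcongr

/-- Pointwise Cauchy estimate with weights: on the circle about `u` of radius half the distance to
the boundary line, both factors of the weight are comparable to their values at `u`. -/
theorem enorm_fiberIntegrand_deriv_le {c : ℝ} {ζ : ℂ} (hζ : 0 < ζ.im + c) (β s : ℝ) {h : ℂ → ℂ}
    (hh : DifferentiableOn ℂ h {u | 0 < u.im - c}) (u : ℂ) :
    ‖fiberIntegrand c ζ (β + 1) s (deriv h) u‖ₑ ≤ ENNReal.ofReal (2 ^ |β| * 2 ^ |-s|) *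
      ∫⁻ θ in Ioc 0 (2 * Real.pi),
        ‖fiberIntegrand c ζ β s h (circleMap u ((u.im - c) / 2) θ)‖ₑ := by
  rcases le_or_gt (u.im - c) 0 with hu | hu
  · simp [fiberIntegrand, posPow_of_nonpos hu]
  set y := u.im - c with hy
  set A := ‖halfPair ζ u‖ with hA
  have hA0 : 0 < A := by
    have := sub_le_two_mul_norm_halfPair hζ u
    linarith
  have hpt : ∀ θ : ℝ, ENNReal.ofReal (y ^ β * A ^ (-s)) * ‖h (circleMap u (y / 2) θ)‖ₑ ≤
      ENNReal.ofReal (2 ^ |β| * 2 ^ |-s|) *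
        ‖fiberIntegrand c ζ β s h (circleMap u (y / 2) θ)‖ₑ := fun θ => by
    set v := circleMap u (y / 2) θ with hv
    have hdist : ‖v - u‖ = y / 2 := by
      rw [hv, circleMap_sub_center]
      simp [circleMap, abs_of_pos hu]
    have him := abs_le.1 ((Complex.abs_im_le_norm (v - u)).trans_eq hdist)
    rw [Complex.sub_im] at him
    have hv0 : 0 < v.im - c := by linarith [him.1]
    have hAd : ‖halfPair ζ v - halfPair ζ u‖ = y / 4 := by
      have : halfPair ζ v - halfPair ζ u = Complex.I / 2 * (starRingEnd ℂ) (v - u) := by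
        simp only [halfPair, map_sub]
        ring
      rw [this, norm_mul, RCLike.norm_conj, hdist]
      simp
      ring
    have hAy := sub_le_two_mul_norm_halfPair hζ u
    have h1 := norm_sub_norm_le (halfPair ζ v) (halfPair ζ u)
    have h2 := norm_sub_norm_le (halfPair ζ u) (halfPair ζ v)
    rw [norm_sub_rev, hAd] at h2
    rw [hAd] at h1
    set A' := ‖halfPair ζ v‖ with hA'
    have e1 := rpow_le_of_comparable hu hv0 (by linarith [him.1]) (by linarith [him.2]) β
    have e2 := rpow_le_of_comparable (x := A) (x' := A') hA0 (by linarith) (by linarith)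
      (by linarith) (-s)
    rw [← ofReal_norm, ← ofReal_norm, ← ENNReal.ofReal_mul (by positivity),
      ← ENNReal.ofReal_mul (by positivity)]
    refine ENNReal.ofReal_le_ofReal ?_
    rw [norm_fiberIntegrand, posPow_of_pos hv0, ← hA', ← mul_assoc]
    refine mul_le_mul_of_nonneg_right ?_ (norm_nonneg _)
    calc y ^ β * A ^ (-s) ≤ (2 ^ |β| * (v.im - c) ^ β) * (2 ^ |-s| * A' ^ (-s)) := by gcongr
      _ = _ := by ring
  have h0 : ‖fiberIntegrand c ζ (β + 1) s (deriv h) u‖ₑ =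
      ENNReal.ofReal (y * (y ^ β * A ^ (-s))) * ‖deriv h u‖ₑ := by
    rw [← ofReal_norm, ← ofReal_norm, norm_fiberIntegrand, posPow_of_pos hu, ← hA,
      ← ENNReal.ofReal_mul (by positivity), Real.rpow_add hu, Real.rpow_one]
    ring_nf
  calc _ ≤ ENNReal.ofReal (y * (y ^ β * A ^ (-s))) * (ENNReal.ofReal (1 / y) *
        ∫⁻ θ in Ioc 0 (2 * Real.pi), ‖h (circleMap u (y / 2) θ)‖ₑ) := by
        rw [h0]
        gcongr
        exact enorm_deriv_le_lintegral_circle hh hu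
    _ = ∫⁻ θ in Ioc 0 (2 * Real.pi),
          ENNReal.ofReal (y ^ β * A ^ (-s)) * ‖h (circleMap u (y / 2) θ)‖ₑ := by
        rw [← mul_assoc, ← ENNReal.ofReal_mul (by positivity),
          lintegral_const_mul' _ _ ENNReal.ofReal_ne_top]
        congr 2
        field_simp
    _ ≤ ∫⁻ θ in Ioc 0 (2 * Real.pi), ENNReal.ofReal (2 ^ |β| * 2 ^ |-s|) *
          ‖fiberIntegrand c ζ β s h (circleMap u (y / 2) θ)‖ₑ := lintegral_mono hpt
    _ = _ := lintegral_const_mul' _ _ ENNReal.ofReal_ne_top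

/-- For fixed `θ`, the map from `u` to a point of its circle is real affine, so that it changes
area by the constant factor `1 + sin θ / 2`. -/
theorem lintegral_comp_circleMap_le (c θ : ℝ) {G : ℂ → ENNReal} (hG : Measurable G) :
    ∫⁻ u : ℂ, G (circleMap u ((u.im - c) / 2) θ) ≤ 2 * ∫⁻ u, G u := by
  set e : ℂ := Complex.exp (θ * Complex.I) / 2 with he
  set L : ℂ →ₗ[ℝ] ℂ := LinearMap.id + Complex.imLm.smulRight e with hL
  have heim : e.im = Real.sin θ / 2 := by
    rw [he, Complex.exp_mul_I]
    simp [← Complex.ofReal_sin, ← Complex.ofReal_cos]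
  have hdet : LinearMap.det L = 1 + Real.sin θ / 2 := by
    rw [← LinearMap.det_toMatrix Complex.basisOneI, Matrix.det_fin_two, ← heim]
    simp [hL, LinearMap.toMatrix_apply]
  have hs := Real.neg_one_le_sin θ
  have hd0 : LinearMap.det L ≠ 0 := by
    rw [hdet]
    linarith
  have hLm : Measurable L := (LinearMap.continuous_of_finiteDimensional L).measurable
  have hpt : ∀ u : ℂ, circleMap u ((u.im - c) / 2) θ = L u - c * e := fun u => by
    simp [circleMap, hL, he]
    ring
  have hle : |(LinearMap.det L)⁻¹| ≤ 2 := by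
    rw [hdet, abs_of_pos (inv_pos.2 (by linarith))]
    exact inv_le_of_inv_le₀ two_pos (by linarith)
  calc ∫⁻ u : ℂ, G (circleMap u ((u.im - c) / 2) θ)
      = ∫⁻ v, G (v - c * e) ∂(Measure.map L volume) := by
        have hGm : Measurable fun v => G (v - c * e) := hG.comp (measurable_sub_const _)
        rw [lintegral_map hGm hLm]
        simp only [hpt]
    _ = ENNReal.ofReal |(LinearMap.det L)⁻¹| * ∫⁻ v, G v := by
        rw [Measure.map_linearMap_addHaar_eq_smul_addHaar volume hd0, lintegral_smul_measure,
          lintegral_sub_right_eq_self, smul_eq_mul]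
    _ ≤ 2 * ∫⁻ u, G u := by
        gcongr
        rw [← ENNReal.ofReal_ofNat]
        exact ENNReal.ofReal_le_ofReal hle

/-- Differentiating `h` and raising the exponent of the distance to the boundary by one preserves
integrability, with a constant that does not depend on `h`, `c` or `ζ`. -/
theorem exists_lintegral_deriv_le (β s : ℝ) : ∃ C : ENNReal, C ≠ ⊤ ∧ ∀ (c : ℝ) (ζ : ℂ),
    0 < ζ.im + c → ∀ h : ℂ → ℂ, DifferentiableOn ℂ h {u | 0 < u.im - c} →
      ∫⁻ u, ‖fiberIntegrand c ζ (β + 1) s (deriv h) u‖ₑ ≤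
        C * ∫⁻ u, ‖fiberIntegrand c ζ β s h u‖ₑ := by
  refine ⟨ENNReal.ofReal (2 ^ |β| * 2 ^ |-s|) * (ENNReal.ofReal (2 * Real.pi) * 2),
    by finiteness, fun c ζ hζ h hh => ?_⟩
  have hm := (measurable_fiberIntegrand hζ β s hh.continuousOn).enorm
  have hcont : Continuous fun p : ℂ × ℝ => circleMap p.1 ((p.1.im - c) / 2) p.2 := by
    unfold circleMap
    fun_prop
  calc ∫⁻ u, ‖fiberIntegrand c ζ (β + 1) s (deriv h) u‖ₑ
      ≤ ∫⁻ u, ENNReal.ofReal (2 ^ |β| * 2 ^ |-s|) * ∫⁻ θ in Ioc 0 (2 * Real.pi),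
          ‖fiberIntegrand c ζ β s h (circleMap u ((u.im - c) / 2) θ)‖ₑ :=
        lintegral_mono fun u => enorm_fiberIntegrand_deriv_le hζ β s hh u
    _ = ENNReal.ofReal (2 ^ |β| * 2 ^ |-s|) * ∫⁻ θ in Ioc 0 (2 * Real.pi), ∫⁻ u,
          ‖fiberIntegrand c ζ β s h (circleMap u ((u.im - c) / 2) θ)‖ₑ := by
        rw [lintegral_const_mul' _ _ ENNReal.ofReal_ne_top, lintegral_lintegral_swap]
        exact (hm.comp hcont.measurable).aemeasurable
    _ ≤ ENNReal.ofReal (2 ^ |β| * 2 ^ |-s|) * ∫⁻ _ in Ioc 0 (2 * Real.pi),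
          2 * ∫⁻ u, ‖fiberIntegrand c ζ β s h u‖ₑ := by
        gcongr with θ
        exact lintegral_comp_circleMap_le c θ hm
    _ = _ := by
        rw [lintegral_const, Measure.restrict_apply MeasurableSet.univ, univ_inter,
          Real.volume_Ioc, sub_zero]
        ring

theorem exists_lintegral_iterate_deriv_le (N : ℕ) (β s : ℝ) : ∃ C : ENNReal, C ≠ ⊤ ∧
    ∀ (c : ℝ) (ζ : ℂ), 0 < ζ.im + c → ∀ h : ℂ → ℂ, DifferentiableOn ℂ h {u | 0 < u.im - c} →
      ∫⁻ u, ‖fiberIntegrand c ζ (β + N) s (deriv^[N] h) u‖ₑ ≤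
        C * ∫⁻ u, ‖fiberIntegrand c ζ β s h u‖ₑ := by
  induction N generalizing β with
  | zero => exact ⟨1, ENNReal.one_ne_top, fun c ζ _ h _ => by simp⟩
  | succ N ih =>
    obtain ⟨C₁, hC₁, h₁⟩ := ih (β + 1)
    obtain ⟨C₂, hC₂, h₂⟩ := exists_lintegral_deriv_le β s
    refine ⟨C₁ * C₂, ENNReal.mul_ne_top hC₁ hC₂, fun c ζ hζ h hh => ?_⟩
    have e : β + ((N + 1 : ℕ) : ℝ) = β + 1 + N := by
      push_cast
      ring
    rw [Function.iterate_succ_apply, e, mul_assoc]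
    exact (h₁ c ζ hζ (deriv h) (hh.deriv (isOpen_halfPlane c))).trans
      (mul_le_mul_right (h₂ c ζ hζ h hh) _)

/-! ### Integration by parts on half-planes -/

theorem halfPair_ne_zero {c : ℝ} {ζ u : ℂ} (hζ : 0 < ζ.im + c) (hu : 0 < u.im - c) :
    halfPair ζ u ≠ 0 := fun h => by
  have := halfPair_re_pos hζ hu
  rw [h] at this
  simp at this

/-- Raising both exponents by one multiplies the integrand by a bounded factor. -/
theorem integrable_fiberIntegrand_add_one {c : ℝ} {ζ : ℂ} (hζ : 0 < ζ.im + c) {β s : ℝ}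
    {h : ℂ → ℂ} (hh : ContinuousOn h {u | 0 < u.im - c})
    (hint : Integrable (fiberIntegrand c ζ β s h)) :
    Integrable (fiberIntegrand c ζ (β + 1) (s + 1) h) := by
  refine (hint.norm.const_mul 2).mono'
    (measurable_fiberIntegrand hζ _ _ hh).aestronglyMeasurable
    (Filter.Eventually.of_forall fun u => ?_)
  rw [norm_fiberIntegrand, norm_fiberIntegrand]
  rcases le_or_gt (u.im - c) 0 with hu | hu
  · simp [posPow_of_nonpos hu]
  have hA := norm_pos_iff.2 (halfPair_ne_zero hζ hu)
  have hy := sub_le_two_mul_norm_halfPair hζ u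
  rw [posPow_of_pos hu, posPow_of_pos hu, Real.rpow_add hu, Real.rpow_one, neg_add,
    Real.rpow_add hA, Real.rpow_neg_one]
  have h1 : (u.im - c) * ‖halfPair ζ u‖⁻¹ ≤ 2 := by
    rw [← div_eq_mul_inv, div_le_iff₀ hA]
    exact hy
  calc (u.im - c) ^ β * (u.im - c) * (‖halfPair ζ u‖ ^ (-s) * ‖halfPair ζ u‖⁻¹) * ‖h u‖
      = ((u.im - c) * ‖halfPair ζ u‖⁻¹) *
          ((u.im - c) ^ β * ‖halfPair ζ u‖ ^ (-s) * ‖h u‖) := by ring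
    _ ≤ _ := by gcongr

theorem integrable_fiberIntegrand_add_nat {c : ℝ} {ζ : ℂ} (hζ : 0 < ζ.im + c) {β s : ℝ}
    {h : ℂ → ℂ} (hh : ContinuousOn h {u | 0 < u.im - c})
    (hint : Integrable (fiberIntegrand c ζ β s h)) (N : ℕ) :
    Integrable (fiberIntegrand c ζ (β + N) (s + N) h) := by
  induction N with
  | zero => simpa using hint
  | succ N ih =>
    have := integrable_fiberIntegrand_add_one hζ hh ih
    simpa only [Nat.cast_add, Nat.cast_one, add_assoc] using this

theorem hasDerivAt_horizontal {c : ℝ} {ζ : ℂ} (hζ : 0 < ζ.im + c) (s : ℝ) {h : ℂ → ℂ}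
    (hh : DifferentiableOn ℂ h {u | 0 < u.im - c}) {y : ℝ} (hy : 0 < y - c) (x : ℝ) :
    HasDerivAt (fun x : ℝ => h (x + y * Complex.I) / halfPair ζ (x + y * Complex.I) ^ (s : ℂ))
      (deriv h (x + y * Complex.I) / halfPair ζ (x + y * Complex.I) ^ (s : ℂ) -
        s * Complex.I / 2 *
          (h (x + y * Complex.I) / halfPair ζ (x + y * Complex.I) ^ ((s + 1 : ℝ) : ℂ))) x := by
  have him : ((x : ℂ) + y * Complex.I).im = y := by simp
  have hu : 0 < ((x : ℂ) + y * Complex.I).im - c := by rwa [him]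
  have hA := halfPair_ne_zero hζ hu
  have hAre := halfPair_re_pos hζ hu
  have hd1 : HasDerivAt (fun w : ℂ => h (w + y * Complex.I)) (deriv h (x + y * Complex.I)) x := by
    have h1 : HasDerivAt h (deriv h (x + y * Complex.I)) (x + y * Complex.I) :=
      ((hh _ hu).differentiableAt ((isOpen_halfPlane c).mem_nhds hu)).hasDerivAt
    exact h1.comp_add_const (x : ℂ) (y * Complex.I)
  -- On the line `Im = y` the antiholomorphic `halfPair ζ` is affine in the real variable, hence
  -- agrees with an affine function of a complex variable.
  set B : ℂ → ℂ := fun w => -(Complex.I / 2) * (ζ - (w - y * Complex.I)) with hB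
  have hBx : ∀ x : ℝ, B x = halfPair ζ (x + y * Complex.I) := fun x => by
    simp only [hB, halfPair, map_add, map_mul, Complex.conj_ofReal, Complex.conj_I]
    ring
  have hd2 : HasDerivAt B (Complex.I / 2) x := by
    refine ((((hasDerivAt_id (x : ℂ)).sub_const _).const_sub ζ).const_mul _).congr_deriv ?_
    ring
  have hd3 := hd2.cpow_const (c := -(s : ℂ)) (by rw [hBx]; exact Or.inl hAre)
  have hd4 := (hd1.mul hd3).comp_ofReal
  have hfun : (fun x : ℝ => h (x + y * Complex.I) / halfPair ζ (x + y * Complex.I) ^ (s : ℂ)) =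
      fun x : ℝ => h (x + y * Complex.I) * B x ^ (-(s : ℂ)) := by
    funext x
    rw [hBx, Complex.cpow_neg, div_eq_mul_inv]
  rw [hfun]
  refine hd4.congr_deriv ?_
  have e : (-(s : ℂ)) - 1 = -((s + 1 : ℝ) : ℂ) := by
    push_cast
    ring
  rw [hBx, e, Complex.cpow_neg, Complex.cpow_neg]
  ring

/-- Integration by parts along horizontal lines, where the weight is constant and there are no
boundary terms: a derivative of `h` is exchanged for one of the kernel. -/
theorem integral_fiberIntegrand_deriv {c : ℝ} {ζ : ℂ} (hζ : 0 < ζ.im + c) {β s : ℝ} {h : ℂ → ℂ}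
    (hh : DifferentiableOn ℂ h {u | 0 < u.im - c})
    (h0 : Integrable (fiberIntegrand c ζ β s h))
    (h1 : Integrable (fiberIntegrand c ζ (β + 1) s (deriv h))) :
    ∫ u, fiberIntegrand c ζ (β + 1) s (deriv h) u =
      s * Complex.I / 2 * ∫ u, fiberIntegrand c ζ (β + 1) (s + 1) h u := by
  have h2 := integrable_fiberIntegrand_add_one hζ hh.continuousOn h0
  have hmp := Complex.volume_preserving_equiv_real_prod.symm
  have hemb := Complex.measurableEquivRealProd.symm.measurableEmbedding
  have hsub := (h1.sub (h2.const_mul (s * Complex.I / 2)))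
  rw [← sub_eq_zero, ← integral_const_mul, ← integral_sub h1 (h2.const_mul _)]
  rw [← hmp.integrable_comp_emb hemb, Measure.volume_eq_prod] at hsub h0
  rw [← hmp.integral_comp hemb, Measure.volume_eq_prod]
  have hz : ∀ p : ℝ × ℝ, Complex.measurableEquivRealProd.symm p = p.1 + p.2 * Complex.I :=
    fun p => Complex.mk_eq_add_mul_I p.1 p.2
  have hslice : ∀ᵐ y : ℝ, ∫ x : ℝ,
      (fiberIntegrand c ζ (β + 1) s (deriv h) (Complex.measurableEquivRealProd.symm (x, y)) -
        s * Complex.I / 2 * fiberIntegrand c ζ (β + 1) (s + 1) h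
          (Complex.measurableEquivRealProd.symm (x, y))) = 0 := by
    filter_upwards [hsub.prod_left_ae, h0.prod_left_ae] with y hy1 hy0
    simp only [Function.comp_apply, hz, Pi.sub_apply] at hy1 hy0 ⊢
    have him : ∀ x : ℝ, ((x : ℂ) + y * Complex.I).im = y := fun x => by simp
    rcases le_or_gt (y - c) 0 with hy | hy
    · simp [fiberIntegrand, posPow_of_nonpos hy]
    refine integral_eq_zero_of_hasDerivAt_of_integrable
      (f := fun x : ℝ => (posPow (β + 1) (y - c) : ℂ) *
        (h (x + y * Complex.I) / halfPair ζ (x + y * Complex.I) ^ (s : ℂ))) (fun x => ?_) hy1 ?_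
    · refine ((hasDerivAt_horizontal hζ s hh hy x).const_mul _).congr_deriv ?_
      simp only [fiberIntegrand, him]
      ring
    · -- On the line, the primitive is the integrand of `h0` times the constant `y - c`.
      refine (hy0.const_mul ((y - c : ℝ) : ℂ)).congr (Filter.Eventually.of_forall fun x => ?_)
      simp only [fiberIntegrand, him, posPow_of_pos hy, Real.rpow_add hy, Real.rpow_one]
      push_cast
      ring
  refine (integral_prod_symm _ hsub).trans ((integral_congr_ae hslice).trans ?_)
  simp

/-- All derivatives of `h` are exchanged for derivatives of the kernel. -/
theorem integral_fiberIntegrand_iterate_deriv (N : ℕ) {c : ℝ} {ζ : ℂ} (hζ : 0 < ζ.im + c)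
    {β s : ℝ} (hs : 0 < s) {h : ℂ → ℂ} (hh : DifferentiableOn ℂ h {u | 0 < u.im - c})
    (h0 : Integrable (fiberIntegrand c ζ β s h)) :
    ∫ u, fiberIntegrand c ζ (β + N) s (deriv^[N] h) u =
      (Complex.I / 2) ^ N * (Real.Gamma (s + N) / Real.Gamma s : ℝ) *
        ∫ u, fiberIntegrand c ζ (β + N) (s + N) h u := by
  induction N generalizing β h with
  | zero => simp [(Real.Gamma_pos_of_pos hs).ne']
  | succ N ih =>
    have hd : DifferentiableOn ℂ (deriv h) {u | 0 < u.im - c} := hh.deriv (isOpen_halfPlane c)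
    have hder : ∀ {β s : ℝ}, Integrable (fiberIntegrand c ζ β s h) →
        Integrable (fiberIntegrand c ζ (β + 1) s (deriv h)) := fun {β s} hi => by
      obtain ⟨C, hC, hCle⟩ := exists_lintegral_deriv_le β s
      exact ⟨(measurable_fiberIntegrand hζ _ _ hd.continuousOn).aestronglyMeasurable,
        (hCle c ζ hζ h hh).trans_lt (ENNReal.mul_lt_top hC.lt_top hi.2)⟩
    have hN := integrable_fiberIntegrand_add_nat hζ hh.continuousOn h0 N
    have e1 : β + ((N + 1 : ℕ) : ℝ) = β + 1 + N := by push_cast; ring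
    have e2 : β + 1 + (N : ℝ) = β + N + 1 := by ring
    have e3 : s + ((N + 1 : ℕ) : ℝ) = s + N + 1 := by push_cast; ring
    have hsN : s + (N : ℝ) ≠ 0 := by positivity
    rw [Function.iterate_succ_apply, e1, ih hd (hder h0), e2, e3,
      integral_fiberIntegrand_deriv hζ hh hN (hder hN), Real.Gamma_add_one hsN]
    push_cast
    ring

/-! ### Derivatives in the last variable on the tube -/

theorem iterate_partialLast {n : ℕ} (N : ℕ) (f : Cn n → ℂ) (w' : Fin (n - 1) → ℂ) (u : ℂ) :
    (partialLast^[N] f) (w', u) = deriv^[N] (fun ξ => f (w', ξ)) u := by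
  induction N generalizing f with
  | zero => rfl
  | succ N ih =>
    rw [Function.iterate_succ_apply, Function.iterate_succ_apply, ih]
    rfl

theorem differentiableOn_fiber {n : ℕ} {f : Cn n → ℂ} (hf : DifferentiableOn ℂ f (tube n))
    (w' : Fin (n - 1) → ℂ) :
    DifferentiableOn ℂ (fun ξ => f (w', ξ)) {u | 0 < u.im - ∑ j, (w' j).im ^ 2} := by
  have hd : Differentiable ℂ fun ξ : ℂ => ((w', ξ) : Cn n) :=
    (differentiable_const w').prodMk differentiable_id
  exact hf.comp hd.differentiableOn fun u hu => mem_tube_iff.2 hu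

theorem differentiableOn_iterate_deriv {s : Set ℂ} (hs : IsOpen s) {h : ℂ → ℂ}
    (hh : DifferentiableOn ℂ h s) (N : ℕ) : DifferentiableOn ℂ (deriv^[N] h) s := by
  induction N with
  | zero => exact hh
  | succ N ih =>
    rw [Function.iterate_succ_apply']
    exact ih.deriv hs

/-- The derivative in the last variable is a limit of difference quotients along real increments,
which do not leave the tube; this gives joint measurability without any several variable theory. -/
theorem measurable_indicator_partialLast {n : ℕ} {G : Cn n → ℂ}
    (hG : Measurable ((tube n).indicator G))
    (hd : ∀ w ∈ tube n, DifferentiableAt ℂ (fun ξ => G (w.1, ξ)) w.2) :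
    Measurable ((tube n).indicator (partialLast G)) := by
  set ε : ℕ → ℂ := fun k => ((1 / ((k : ℝ) + 1) : ℝ) : ℂ) with hε
  set D : ℕ → Cn n → ℂ := fun k w =>
    (ε k)⁻¹ * ((tube n).indicator G (w.1, w.2 + ε k) - (tube n).indicator G w) with hD
  have hshift : ∀ k w, ((w.1, w.2 + ε k) : Cn n) ∈ tube n ↔ w ∈ tube n := fun k w => by
    simp only [mem_tube_iff, rho, hε, Complex.add_im, Complex.ofReal_im, add_zero]
  refine measurable_of_tendsto_metrizable (f := D) (fun k => ?_) (tendsto_pi_nhds.2 fun w => ?_)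
  · have hm : Measurable fun w : Cn n => ((w.1, w.2 + ε k) : Cn n) :=
      measurable_fst.prodMk (measurable_snd.add_const _)
    exact ((hG.comp hm).sub hG).const_mul _
  by_cases hw : w ∈ tube n
  · have h1 : ∀ k, D k w = (ε k)⁻¹ • (G (w.1, w.2 + ε k) - G (w.1, w.2)) := fun k => by
      simp only [hD, indicator_of_mem hw, indicator_of_mem ((hshift k w).2 hw), smul_eq_mul,
        Prod.mk.eta]
    have hε0 : Filter.Tendsto ε Filter.atTop (nhdsWithin 0 {0}ᶜ) := by
      refine tendsto_nhdsWithin_iff.2 ⟨?_, Filter.Eventually.of_forall fun k => ?_⟩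
      · have := (Complex.continuous_ofReal.tendsto 0).comp
          (tendsto_one_div_add_atTop_nhds_zero_nat (𝕜 := ℝ))
        simpa only [hε, Function.comp_def, Complex.ofReal_zero] using this
      · have : (0 : ℝ) < 1 / ((k : ℝ) + 1) := by positivity
        simpa only [hε, mem_compl_iff, mem_singleton_iff, Complex.ofReal_eq_zero] using this.ne'
    have h2 := (hasDerivAt_iff_tendsto_slope_zero.1 (hd w hw).hasDerivAt).comp hε0
    rw [indicator_of_mem hw]
    refine Filter.Tendsto.congr (fun k => ?_) h2
    rw [h1]
    rfl
  · have h1 : ∀ k, D k w = 0 := fun k => by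
      simp only [hD, indicator_of_notMem hw, indicator_of_notMem (mt (hshift k w).1 hw), sub_zero,
        mul_zero]
    simp only [h1, indicator_of_notMem hw]
    exact tendsto_const_nhds

theorem measurable_indicator_iterate_partialLast {n : ℕ} {f : Cn n → ℂ}
    (hf : DifferentiableOn ℂ f (tube n)) (N : ℕ) :
    Measurable ((tube n).indicator (partialLast^[N] f)) := by
  induction N with
  | zero =>
    classical
    rw [Function.iterate_zero_apply, ← piecewise_eq_indicator]
    exact hf.continuousOn.measurable_piecewise continuousOn_const (isOpen_tube n).measurableSet
  | succ N ih =>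
    rw [Function.iterate_succ_apply']
    refine measurable_indicator_partialLast ih fun w hw => ?_
    simp only [iterate_partialLast]
    have ho := isOpen_halfPlane (∑ j, (w.1 j).im ^ 2)
    exact (differentiableOn_iterate_deriv ho (differentiableOn_fiber hf w.1) N).differentiableAt
      (ho.mem_nhds (mem_tube_iff.1 hw))

/-- The factor `ρ(w)^N` raises the exponent of the weight, and on each fibre the integrand becomes
a `fiberIntegrand`. -/
theorem indicator_integrand_iterate {n : ℕ} (α : ℝ) (N : ℕ) (f : Cn n → ℂ) (z : Cn n) :
    (tube n).indicator (integrand α (fun w => (rho w : ℂ) ^ N * (partialLast^[N] f) w) z) =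
      fun w => fiberIntegrand (∑ j, (w.1 j).im ^ 2) (fiberPoint z w.1) (α + N) (n + 1 + α)
        (deriv^[N] fun ξ => f (w.1, ξ)) w.2 := by
  rw [indicator_integrand]
  funext w
  rw [fiberIntegrand, ← iterate_partialLast, ← rhoPair_eq_halfPair_fiberPoint]
  change (posPow α (rho w) : ℂ) * _ = (posPow (α + N) (rho w) : ℂ) * _
  rcases le_or_gt (rho w) 0 with hw | hw
  · simp [posPow_of_nonpos hw]
  · rw [posPow_of_pos hw, posPow_of_pos hw, Real.rpow_add hw, Real.rpow_natCast]
    push_cast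
    ring

theorem indicator_integrand_add {n : ℕ} (α : ℝ) (N : ℕ) (f : Cn n → ℂ) (z : Cn n) :
    (tube n).indicator (integrand (α + N) f z) =
      fun w => fiberIntegrand (∑ j, (w.1 j).im ^ 2) (fiberPoint z w.1) (α + N) (n + 1 + α + N)
        (fun ξ => f (w.1, ξ)) w.2 := by
  rw [indicator_integrand, ← add_assoc]
  funext w
  rw [fiberIntegrand, ← rhoPair_eq_halfPair_fiberPoint]
  rfl

theorem fiberPoint_im_pos {n : ℕ} {z : Cn n} (hz : z ∈ tube n) (w' : Fin (n - 1) → ℂ) :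
    0 < (fiberPoint z w').im + ∑ j, (w' j).im ^ 2 := by
  have h1 := rho_sub_le_fiberPoint_im z w'
  have h2 := mem_tube_iff.1 hz
  linarith

section Fibres

variable {n : ℕ} {α : ℝ} {f : Cn n → ℂ} {z : Cn n}

theorem integrableOn_integrand_iterate (hf : DifferentiableOn ℂ f (tube n)) (hz : z ∈ tube n)
    (hint : IntegrableOn (integrand α f z) (tube n)) (N : ℕ) :
    IntegrableOn (integrand α (fun w => (rho w : ℂ) ^ N * (partialLast^[N] f) w) z) (tube n) := by
  have hmeas := (isOpen_tube n).measurableSet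
  have hm : Measurable ((tube n).indicator
      (integrand α (fun w => (rho w : ℂ) ^ N * (partialLast^[N] f) w) z)) := by
    have : (tube n).indicator
        (integrand α (fun w => (rho w : ℂ) ^ N * (partialLast^[N] f) w) z) = fun w =>
        (posPow α (rho w) : ℂ) * ((rho w : ℂ) ^ N * (tube n).indicator (partialLast^[N] f) w /
          rhoPair z w ^ ((n + 1 + α : ℝ) : ℂ)) := by
      rw [indicator_integrand]
      funext w
      by_cases hw : w ∈ tube n
      · rw [indicator_of_mem hw]
      · simp [posPow_of_nonpos (not_lt.1 (mt mem_tube_iff.2 hw))]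
    rw [this]
    have h1 := measurable_indicator_iterate_partialLast hf N
    have h2 := (continuous_rho (n := n)).measurable
    have h3 := (continuous_rhoPair z).measurable
    exact (Complex.measurable_ofReal.comp ((measurable_posPow α).comp h2)).mul
      ((((Complex.measurable_ofReal.comp h2).pow_const N).mul h1).div (h3.pow_const _))
  obtain ⟨C, hC, hCle⟩ := exists_lintegral_iterate_deriv_le N α (n + 1 + α)
  have h0 := indicator_integrand_iterate α 0 f z
  simp only [pow_zero, one_mul, Function.iterate_zero_apply, Nat.cast_zero, add_zero] at h0
  rw [← integrable_indicator_iff hmeas] at hint ⊢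
  refine ⟨hm.aestronglyMeasurable, ?_⟩
  have hfin := hint.2
  rw [HasFiniteIntegral, Measure.volume_eq_prod,
    lintegral_prod _ hint.1.enorm] at hfin
  rw [HasFiniteIntegral, Measure.volume_eq_prod, lintegral_prod _ hm.enorm.aemeasurable]
  simp only [h0] at hfin
  simp only [indicator_integrand_iterate]
  refine lt_of_le_of_lt (lintegral_mono fun w' =>
    hCle _ _ (fiberPoint_im_pos hz w') _ (differentiableOn_fiber hf w')) ?_
  rw [lintegral_const_mul' _ _ hC]
  exact ENNReal.mul_lt_top hC.lt_top hfin

theorem integrableOn_integrand_add_nat (hf : DifferentiableOn ℂ f (tube n)) (hz : z ∈ tube n)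
    (hint : IntegrableOn (integrand α f z) (tube n)) (N : ℕ) :
    IntegrableOn (integrand (α + N) f z) (tube n) := by
  have hmeas := (isOpen_tube n).measurableSet
  have hm : Measurable ((tube n).indicator (integrand (α + N) f z)) := by
    rw [indicator_integrand]
    refine measurable_posPow_mul continuous_rho (ContinuousOn.div ?_ ?_ fun w hw => ?_) _
    · exact hf.continuousOn.mono fun w hw => mem_tube_iff.2 hw
    · exact (continuous_rhoPair z).continuousOn.cpow_const fun w hw =>
        Or.inl (rhoPair_re_pos hz (mem_tube_iff.2 hw))
    · rw [Complex.cpow_ne_zero_iff]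
      exact Or.inl (rhoPair_ne_zero hz (mem_tube_iff.2 hw))
  rw [← integrable_indicator_iff hmeas] at hint ⊢
  refine (hint.norm.const_mul (2 ^ N)).mono' hm.aestronglyMeasurable
    (Filter.Eventually.of_forall fun w => ?_)
  by_cases hw : w ∈ tube n
  · have hρ := mem_tube_iff.1 hw
    have hA := norm_pos_iff.2 (rhoPair_ne_zero hz hw)
    have hle : rho w ≤ 2 * ‖rhoPair z w‖ := by
      have h1 := rho_add_rho_le_norm_rhoPair z w
      have h2 := mem_tube_iff.1 hz
      linarith
    have hq : rho w ^ N ≤ 2 ^ N * ‖rhoPair z w‖ ^ N := by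
      rw [← mul_pow]
      exact pow_le_pow_left₀ hρ.le hle N
    rw [indicator_of_mem hw, indicator_of_mem hw, integrand, integrand]
    simp only [norm_mul, norm_div, Complex.norm_cpow_real, Complex.norm_real, Real.norm_eq_abs,
      abs_of_pos (Real.rpow_pos_of_pos hρ _)]
    rw [← add_assoc, Real.rpow_add hρ, Real.rpow_add hA, Real.rpow_natCast, Real.rpow_natCast]
    have hq' : rho w ^ N / ‖rhoPair z w‖ ^ N ≤ 2 ^ N := by
      rw [div_le_iff₀ (by positivity)]
      exact hq
    calc rho w ^ α * rho w ^ N / (‖rhoPair z w‖ ^ (n + 1 + α) * ‖rhoPair z w‖ ^ N) * ‖f w‖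
        = rho w ^ N / ‖rhoPair z w‖ ^ N *
            (rho w ^ α / ‖rhoPair z w‖ ^ (n + 1 + α) * ‖f w‖) := by field_simp
      _ ≤ _ := by gcongr
  · simp [indicator_of_notMem hw]

/-- Integration by parts `N` times in the real part of the last variable. -/
theorem integral_integrand_iterate (hα : -1 < α) (hf : DifferentiableOn ℂ f (tube n))
    (hz : z ∈ tube n) (hint : IntegrableOn (integrand α f z) (tube n)) (N : ℕ) :
    ∫ w in tube n, integrand α (fun w => (rho w : ℂ) ^ N * (partialLast^[N] f) w) z w =
      (Complex.I / 2) ^ N * (Real.Gamma (n + 1 + α + N) / Real.Gamma (n + 1 + α) : ℝ) *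
        ∫ w in tube n, integrand (α + N) f z w := by
  have hmeas := (isOpen_tube n).measurableSet
  have hs : 0 < n + 1 + α := by linarith [Nat.cast_nonneg (α := ℝ) n]
  have h1 := integrableOn_integrand_iterate hf hz hint N
  have h2 := integrableOn_integrand_add_nat hf hz hint N
  have h0 := indicator_integrand_iterate α 0 f z
  simp only [pow_zero, one_mul, Function.iterate_zero_apply, Nat.cast_zero, add_zero] at h0
  rw [← integrable_indicator_iff hmeas] at hint h1 h2
  rw [← integral_indicator hmeas, ← integral_indicator hmeas]
  rw [indicator_integrand_iterate, Measure.volume_eq_prod] at h1 ⊢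
  rw [indicator_integrand_add, Measure.volume_eq_prod] at h2
  rw [indicator_integrand_add]
  rw [h0, Measure.volume_eq_prod] at hint
  rw [integral_prod _ h1, integral_prod _ h2, ← integral_const_mul]
  refine integral_congr_ae ?_
  filter_upwards [hint.prod_right_ae] with w' hw'
  exact integral_fiberIntegrand_iterate_deriv N (fiberPoint_im_pos hz w') hs
    (differentiableOn_fiber hf w') hw'

end Fibres

end TubeDomain

end

theorem theoremD (n : ℕ) (hn : 1 ≤ n) (p lam α : ℝ) (hp : 1 ≤ p) (hlam : -1 < lam)
    (hα_gt : 1 < p → (lam + 1) / p - 1 < α) (hα_ge : p = 1 → lam ≤ α)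
    (f : TubeDomain.Cn n → ℂ) (hf : TubeDomain.MemBergman n p lam f) (N : ℕ)
    (z : TubeDomain.Cn n) (hz : z ∈ TubeDomain.tube n) :
    MeasureTheory.IntegrableOn
      (TubeDomain.integrand α
        (fun w => (TubeDomain.rho w : ℂ) ^ N * (TubeDomain.partialLast^[N] f) w) z)
      (TubeDomain.tube n) MeasureTheory.volume ∧
    f z = (-2 * Complex.I) ^ N * ((Real.Gamma (1 + α) / Real.Gamma (1 + α + N) : ℝ) : ℂ) *
      TubeDomain.T α
        (fun w => (TubeDomain.rho w : ℂ) ^ N * (TubeDomain.partialLast^[N] f) w) z := by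
  have hα : -1 < α := by
    rcases hp.eq_or_lt with h | h
    · exact hlam.trans_le (hα_ge h.symm)
    · have h1 := hα_gt h
      have h2 : 0 < (lam + 1) / p := div_pos (by linarith) (by linarith)
      linarith
  have hint := TubeDomain.integrableOn_integrand hn hp hlam hα_gt hα_ge hf hz
  refine ⟨TubeDomain.integrableOn_integrand_iterate hf.1 hz hint N, ?_⟩
  have hN : (0 : ℝ) ≤ N := Nat.cast_nonneg N
  have hn0 : (0 : ℝ) ≤ n := Nat.cast_nonneg n
  rw [TubeDomain.T, TubeDomain.integral_integrand_iterate hα hf.1 hz hint N,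
    TubeDomain.integral_reproducing hn (by linarith : -1 < α + N) hf.1 hz
      (TubeDomain.integrableOn_integrand_add_nat hf.1 hz hint N)]
  have hI : (-2 * Complex.I) ^ N * (Complex.I / 2) ^ N = 1 := by
    rw [← mul_pow, show -2 * Complex.I * (Complex.I / 2) = -(Complex.I * Complex.I) by ring,
      Complex.I_mul_I, neg_neg, one_pow]
  have g1 := Real.Gamma_pos_of_pos (show 0 < 1 + α by linarith)
  have g2 := Real.Gamma_pos_of_pos (show 0 < 1 + α + N by linarith)
  have g3 := Real.Gamma_pos_of_pos (show 0 < n + 1 + α by linarith)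
  have g4 := Real.Gamma_pos_of_pos (show 0 < n + 1 + α + N by linarith)
  have hreal : Real.Gamma (1 + α) / Real.Gamma (1 + α + N) *
      (Real.Gamma (n + 1 + α) / (2 ^ (n + 1) * Real.pi ^ n * Real.Gamma (α + 1))) *
      (Real.Gamma (n + 1 + α + N) / Real.Gamma (n + 1 + α)) *
      (2 ^ (n + 1) * Real.pi ^ n * Real.Gamma (α + N + 1) / Real.Gamma (n + 1 + (α + N))) = 1 := by
    rw [show α + N + 1 = 1 + α + N by ring, show n + 1 + (α + N) = n + 1 + α + N by ring,
      add_comm α 1]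
    have hπ := Real.pi_pos
    field_simp
  generalize Real.Gamma (1 + α) / Real.Gamma (1 + α + N) = a at hreal ⊢
  generalize Real.Gamma (n + 1 + α) / (2 ^ (n + 1) * Real.pi ^ n * Real.Gamma (α + 1)) = b
    at hreal ⊢
  generalize Real.Gamma (n + 1 + α + N) / Real.Gamma (n + 1 + α) = c at hreal ⊢
  generalize 2 ^ (n + 1) * Real.pi ^ n * Real.Gamma (α + N + 1) /
    Real.Gamma (n + 1 + (α + N)) = d at hreal ⊢
  have hcplx : (a * b * c * d : ℂ) = 1 := by exact_mod_cast hreal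
  calc f z = ((-2 * Complex.I) ^ N * (Complex.I / 2) ^ N) * (a * b * c * d : ℂ) * f z := by
        rw [hI, hcplx, one_mul, one_mul]
    _ = _ := by ring
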